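/- Let $M$ be a smooth manifold of dimension $2n+1$ ($n\ge 0$) with a Sasaki–Einstein structure $(g,\Phi,\xi,\eta)$: $g$ is a Riemannian metric with Levi-Civita connection $\nabla$, $\xi$ is a Killing vector field with $g(\xi,\xi)=1$, $\eta=g(\xi,\cdot)$, $\Phi=\nabla\xi$ satisfies $(\nabla_X\Phi)Y=g(\xi,Y)X-g(X,Y)\xi$ for all vector fields $X,Y$ (these conditions say that $(g,\Phi,\xi,\eta)$ is a Sasaki structure), and $\mathrm{Ric}_g=\lambda g$ for some constant $\lambda\in\mathbb R$. The exterior derivative of a one-form is normalized by $d\alpha(X,Y)=\tfrac12\big(X\alpha(Y)-Y\alpha(X)-\alpha([X,Y])\big)$, so that $g^T:=d\eta(\mathrm{Id}\otimes\Phi)$, i.e. $g^T(X,Y)=d\eta(X,\Phi Y)$, is the transverse metric and $g=g^T+\eta\otimes\eta$. Let $U\subseteq M$ be open and let $\varphi:U\to\mathbb R$ be a smooth basic function, i.e. $\xi(\varphi)=0$ on $U$. Let $\partial_B\varphi=\tfrac12(d\varphi-i\,d\varphi\circ\Phi)$ and $\bar\partial_B\varphi=\tfrac12(d\varphi+i\,d\varphi\circ\Phi)$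 be the components of type $(1,0)$ and $(0,1)$ of $d\varphi$ with respect to the transverse complex structure induced by $\Phi$, let $\partial_B\bar\partial_B\varphi$ be the component of type $(1,1)$ of $d(\bar\partial_B\varphi)$, where the component of type $(1,1)$ of a basic two-form $\omega$ is $\tfrac12(\omega+\omega(\Phi\cdot,\Phi\cdot))$, and let $d^c_B\varphi=\tfrac i2(\bar\partial_B\varphi-\partial_B\varphi)$, which is a real one-form. Suppose that $\partial_B\bar\partial_B\varphi=0$ on $U$, and put, on $U$, $$\tilde\eta=\eta+d^c_B\varphi,\qquad \tilde\Phi=\Phi-(\xi\otimes d^c_B\varphi)\circ\Phi,\qquad \tilde g=d\tilde\eta(\mathrm{Id}\otimes\tilde\Phi)+\tilde\eta\otimes\tilde\eta .$$ Then $(\tilde g,\tilde\Phi,\xi,\tilde\eta)$ is a Sasaki–Einstein structure on $U$; in particular the metric $\tilde g$ is Sasaki–Einstein on $U$. Moreover the transverse metric is unchanged: $d\tilde\eta(\mathrm{Id}\otimes\tilde\Phi)=d\eta(\mathrm{Id}\otimes\Phi)$ on $U$. -/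

import Mathlib

open Bundle VectorField
open scoped Manifold ContDiff Topology

noncomputable section

namespace SasakiEinstein

section Fields

variable (d : ℕ) (M : Type*) [TopologicalSpace M] [ChartedSpace (EuclideanSpace ℝ (Fin d)) M]

/-- Vector fields (no regularity) on a `d`-dimensional manifold. -/
abbrev VField : Type _ := Π x : M, TangentSpace (𝓡 d) x

/-- One-forms (no regularity) with values in a real normed space `F`. -/
abbrev OneForm (F : Type*) [NormedAddCommGroup F] [NormedSpace ℝ F] : Type _ :=
  Π x : M, TangentSpace (𝓡 d) x →L[ℝ] F

/-- Two-forms, or more generally bilinear forms, with values in a real normed space `F`. -/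
abbrev BilinField (F : Type*) [NormedAddCommGroup F] [NormedSpace ℝ F] : Type _ :=
  Π x : M, TangentSpace (𝓡 d) x →L[ℝ] TangentSpace (𝓡 d) x →L[ℝ] F

/-- Fields of endomorphisms of the tangent spaces. -/
abbrev EndField : Type _ :=
  Π x : M, TangentSpace (𝓡 d) x →L[ℝ] TangentSpace (𝓡 d) x

/-- Operators `Y ↦ ∇Y` on vector fields; `D Y x v` stands for `(∇_v Y)(x)`. -/
abbrev AffineOp : Type _ := VField d M → EndField d M

end Fields

variable {d : ℕ} {M : Type*} [TopologicalSpace M] [ChartedSpace (EuclideanSpace ℝ (Fin d)) M]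
  [IsManifold (𝓡 d) ∞ M]

/-! ### Regularity of tensor fields, as sections of the corresponding bundles -/

section Regularity

/-- The vector field `X` is differentiable at `x`. -/
def VDiffAt (X : VField d M) (x : M) : Prop :=
  MDifferentiableAt (𝓡 d) ((𝓡 d).prod 𝓘(ℝ, EuclideanSpace ℝ (Fin d)))
    (fun y ↦ TotalSpace.mk' (EuclideanSpace ℝ (Fin d)) y (X y)) x

/-- The vector field `X` is smooth at `x`. -/
def VSmoothAt (X : VField d M) (x : M) : Prop :=
  ContMDiffAt (𝓡 d) ((𝓡 d).prod 𝓘(ℝ, EuclideanSpace ℝ (Fin d))) ∞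
    (fun y ↦ TotalSpace.mk' (EuclideanSpace ℝ (Fin d)) y (X y)) x

variable {F : Type*} [NormedAddCommGroup F] [NormedSpace ℝ F]

/-- The one-form `α` is differentiable at `x`. -/
def FormDiffAt (α : OneForm d M F) (x : M) : Prop :=
  MDifferentiableAt (𝓡 d) ((𝓡 d).prod 𝓘(ℝ, EuclideanSpace ℝ (Fin d) →L[ℝ] F))
    (fun y ↦ TotalSpace.mk' (EuclideanSpace ℝ (Fin d) →L[ℝ] F)
      (E := fun y : M ↦ TangentSpace (𝓡 d) y →L[ℝ] Trivial M F y) y (α y)) x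

/-- The one-form `α` is smooth at `x`. -/
def FormSmoothAt (α : OneForm d M F) (x : M) : Prop :=
  ContMDiffAt (𝓡 d) ((𝓡 d).prod 𝓘(ℝ, EuclideanSpace ℝ (Fin d) →L[ℝ] F)) ∞
    (fun y ↦ TotalSpace.mk' (EuclideanSpace ℝ (Fin d) →L[ℝ] F)
      (E := fun y : M ↦ TangentSpace (𝓡 d) y →L[ℝ] Trivial M F y) y (α y)) x

/-- The field of bilinear forms `g` is smooth at `x`. -/
def BilinSmoothAt (g : BilinField d M F) (x : M) : Prop :=
  ContMDiffAt (𝓡 d)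
    ((𝓡 d).prod 𝓘(ℝ, EuclideanSpace ℝ (Fin d) →L[ℝ] EuclideanSpace ℝ (Fin d) →L[ℝ] F)) ∞
    (fun y ↦ TotalSpace.mk' (EuclideanSpace ℝ (Fin d) →L[ℝ] EuclideanSpace ℝ (Fin d) →L[ℝ] F)
      (E := fun y : M ↦ TangentSpace (𝓡 d) y →L[ℝ] TangentSpace (𝓡 d) y →L[ℝ] Trivial M F y)
      y (g y)) x

/-- The endomorphism field `A` is smooth at `x`. -/
def EndSmoothAt (A : EndField d M) (x : M) : Prop :=
  ContMDiffAt (𝓡 d)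
    ((𝓡 d).prod 𝓘(ℝ, EuclideanSpace ℝ (Fin d) →L[ℝ] EuclideanSpace ℝ (Fin d))) ∞
    (fun y ↦ TotalSpace.mk' (EuclideanSpace ℝ (Fin d) →L[ℝ] EuclideanSpace ℝ (Fin d))
      (E := fun y : M ↦ TangentSpace (𝓡 d) y →L[ℝ] TangentSpace (𝓡 d) y) y (A y)) x

end Regularity

/-! ### The exterior derivative of a one-form -/

section ExteriorDerivative

variable {F : Type*} [NormedAddCommGroup F] [NormedSpace ℝ F]

/-- `X(α(Y)) - Y(α(X)) - α([X, Y])` at the point `x`. -/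
def extDerivAux (α : OneForm d M F) (x : M) (X Y : VField d M) : F :=
  mvfderiv (𝓡 d) (fun y ↦ α y (Y y)) x (X x) - mvfderiv (𝓡 d) (fun y ↦ α y (X y)) x (Y x)
    - α x (mlieBracket (𝓡 d) X Y x)

theorem FormDiffAt.apply {α : OneForm d M F} {x : M} (hα : FormDiffAt α x) {Y : VField d M}
    (hY : VDiffAt Y x) : MDifferentiableAt (𝓡 d) 𝓘(ℝ, F) (fun y ↦ α y (Y y)) x := by
  have : MDifferentiableAt (𝓡 d) ((𝓡 d).prod 𝓘(ℝ, F))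
      (fun m ↦ TotalSpace.mk' F (E := Bundle.Trivial M F) m (α m (Y m))) x := by
    apply MDifferentiableAt.clm_bundle_apply (F₁ := EuclideanSpace ℝ (Fin d))
    · exact hα
    · exact hY
  simp only [mdifferentiableAt_totalSpace] at this
  exact this.2

theorem extDerivAux_swap (α : OneForm d M F) (x : M) (X Y : VField d M) :
    extDerivAux α x X Y = - extDerivAux α x Y X := by
  simp only [extDerivAux, mlieBracket_swap_apply (V := X) (W := Y), map_neg]
  abel

theorem extDerivAux_tensorial₁ {α : OneForm d M F} {x : M} (hα : FormDiffAt α x)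
    (Y : VField d M) :
    TensorialAt (𝓡 d) (EuclideanSpace ℝ (Fin d)) (extDerivAux α x · Y) x where
  smul {f X} hf hX := by
    have h1 : (fun y ↦ α y ((f • X) y)) = f • (fun y ↦ α y (X y)) := by
      ext y; simp
    simp only [extDerivAux, h1, mlieBracket_smul_left hf hX]
    rw [mvfderiv_smul hf (hα.apply hX)]
    simp
    module
  add {X X'} hX hX' := by
    have h1 : (fun y ↦ α y ((X + X') y)) = (fun y ↦ α y (X y)) + (fun y ↦ α y (X' y)) := by
      ext y; simp
    simp only [extDerivAux, h1, mlieBracket_add_left hX hX']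
    rw [mvfderiv_add (hα.apply hX) (hα.apply hX')]
    simp
    abel

theorem extDerivAux_tensorial₂ {α : OneForm d M F} {x : M} (hα : FormDiffAt α x)
    (X : VField d M) :
    TensorialAt (𝓡 d) (EuclideanSpace ℝ (Fin d)) (extDerivAux α x X) x where
  smul {f Y} hf hY := by
    rw [extDerivAux_swap, (extDerivAux_tensorial₁ hα X).smul hf hY, extDerivAux_swap α x X Y,
      smul_neg]
  add {Y Y'} hY hY' := by
    rw [extDerivAux_swap, (extDerivAux_tensorial₁ hα X).add hY hY', extDerivAux_swap α x X Y,
      extDerivAux_swap α x X Y', neg_add]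

open scoped Classical in
/-- The exterior derivative of a one-form, in the normalisation
`dα(X, Y) = X(α(Y)) - Y(α(X)) - α([X, Y])` (see `extDeriv_apply`); it is set to `0` at the points
where `α` is not differentiable. -/
def extDeriv (α : OneForm d M F) : BilinField d M F := fun x ↦
  if hα : FormDiffAt α x then
    TensorialAt.mkHom₂ (extDerivAux α x) x
      (fun Y _ ↦ extDerivAux_tensorial₁ hα Y) (fun X _ ↦ extDerivAux_tensorial₂ hα X)
  else 0

theorem extDeriv_apply {α : OneForm d M F} {x : M} (hα : FormDiffAt α x) {X Y : VField d M}
    (hX : VDiffAt X x) (hY : VDiffAt Y x) :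
    extDeriv α x (X x) (Y x) =
      mvfderiv (𝓡 d) (fun y ↦ α y (Y y)) x (X x) - mvfderiv (𝓡 d) (fun y ↦ α y (X y)) x (Y x)
        - α x (mlieBracket (𝓡 d) X Y x) := by
  rw [extDeriv, dif_pos hα]
  exact TensorialAt.mkHom₂_apply _ _ hX hY

end ExteriorDerivative

/-! ### Riemannian metrics, the Levi-Civita connection, curvature, Einstein metrics

All the notions are local; they are defined relative to an open subset `U` of the manifold, and
the values of the fields outside `U` play no role. -/

section Riemannian

/-- `g` is a smooth Riemannian metric on the open set `U`. -/
structure IsRiemannianMetricOn (g : BilinField d M ℝ) (U : Set M) : Prop where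
  smooth : ∀ x ∈ U, BilinSmoothAt g x
  symm : ∀ x ∈ U, ∀ v w : TangentSpace (𝓡 d) x, g x v w = g x w v
  pos : ∀ x ∈ U, ∀ v : TangentSpace (𝓡 d) x, v ≠ 0 → 0 < g x v v

/-- `D` is the Levi-Civita connection of `g` on the open set `U`: a smooth affine connection which
is torsion free and compatible with `g`. -/
structure IsLeviCivitaOn (g : BilinField d M ℝ) (D : AffineOp d M) (U : Set M) : Prop where
  isCovariantDerivative : IsCovariantDerivativeOn (EuclideanSpace ℝ (Fin d)) D U
  smooth : ∀ x ∈ U, ∀ Y : VField d M, VSmoothAt Y x → EndSmoothAt (D Y) x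
  torsion_free : ∀ x ∈ U, ∀ X Y : VField d M, VDiffAt X x → VDiffAt Y x →
    D Y x (X x) - D X x (Y x) = mlieBracket (𝓡 d) X Y x
  metric : ∀ x ∈ U, ∀ Y Z : VField d M, VDiffAt Y x → VDiffAt Z x →
    ∀ v : TangentSpace (𝓡 d) x,
      mvfderiv (𝓡 d) (fun y ↦ g y (Y y) (Z y)) x v = g x (D Y x v) (Z x) + g x (Y x) (D Z x v)

/-- `R` is the curvature tensor of the connection `D` on the open set `U`:
`R(X, Y) Z = ∇_X ∇_Y Z - ∇_Y ∇_X Z - ∇_{[X, Y]} Z`. -/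
def IsCurvatureOn (D : AffineOp d M)
    (R : Π x : M, TangentSpace (𝓡 d) x →ₗ[ℝ] TangentSpace (𝓡 d) x →ₗ[ℝ]
      TangentSpace (𝓡 d) x →ₗ[ℝ] TangentSpace (𝓡 d) x) (U : Set M) : Prop :=
  ∀ x ∈ U, ∀ X Y Z : VField d M, VSmoothAt X x → VSmoothAt Y x → VSmoothAt Z x →
    R x (X x) (Y x) (Z x) =
      D (fun y ↦ D Z y (Y y)) x (X x) - D (fun y ↦ D Z y (X y)) x (Y x)
        - D Z x (mlieBracket (𝓡 d) X Y x)

/-- The Ricci tensor of a curvature tensor at a point: `Ric(v, w) = tr (u ↦ R(u, v) w)`. -/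
def ricci {x : M} (R : TangentSpace (𝓡 d) x →ₗ[ℝ] TangentSpace (𝓡 d) x →ₗ[ℝ]
    TangentSpace (𝓡 d) x →ₗ[ℝ] TangentSpace (𝓡 d) x) (v w : TangentSpace (𝓡 d) x) : ℝ :=
  LinearMap.trace ℝ (TangentSpace (𝓡 d) x) ((R.flip v).flip w)

/-- The metric `g`, with Levi-Civita connection `D`, is Einstein on `U`: its Ricci tensor is a
constant multiple of `g`. -/
def IsEinsteinOn (g : BilinField d M ℝ) (D : AffineOp d M) (U : Set M) : Prop :=
  ∃ R : Π x : M, TangentSpace (𝓡 d) x →ₗ[ℝ] TangentSpace (𝓡 d) x →ₗ[ℝ]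
      TangentSpace (𝓡 d) x →ₗ[ℝ] TangentSpace (𝓡 d) x,
    IsCurvatureOn D R U ∧
      ∃ c : ℝ, ∀ x ∈ U, ∀ v w : TangentSpace (𝓡 d) x, ricci (R x) v w = c * g x v w

end Riemannian

/-! ### Sasaki and Sasaki-Einstein structures -/

section Sasaki

/-- `(g, Φ, ξ, η)` is a Sasaki structure on the open set `U`, where `D` is the Levi-Civita
connection of `g`: the Reeb field `ξ` is a Killing field of unit length, `η = g(ξ, ·)`, `Φ = ∇ξ`
and `(∇_X Φ) Y = g(ξ, Y) X - g(X, Y) ξ`. -/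
structure IsSasakiOn (g : BilinField d M ℝ) (Φ : EndField d M) (ξ : VField d M)
    (η : OneForm d M ℝ) (D : AffineOp d M) (U : Set M) : Prop where
  isRiemannianMetric : IsRiemannianMetricOn g U
  isLeviCivita : IsLeviCivitaOn g D U
  smooth_Φ : ∀ x ∈ U, EndSmoothAt Φ x
  smooth_ξ : ∀ x ∈ U, VSmoothAt ξ x
  smooth_η : ∀ x ∈ U, FormSmoothAt η x
  unit : ∀ x ∈ U, g x (ξ x) (ξ x) = 1
  killing : ∀ x ∈ U, ∀ v w : TangentSpace (𝓡 d) x, g x (D ξ x v) w + g x v (D ξ x w) = 0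
  η_eq : ∀ x ∈ U, ∀ v : TangentSpace (𝓡 d) x, η x v = g x (ξ x) v
  Φ_eq : ∀ x ∈ U, ∀ v : TangentSpace (𝓡 d) x, Φ x v = D ξ x v
  deriv_Φ : ∀ x ∈ U, ∀ Y : VField d M, VDiffAt Y x → ∀ v : TangentSpace (𝓡 d) x,
    D (fun y ↦ Φ y (Y y)) x v - Φ x (D Y x v) = g x (ξ x) (Y x) • v - g x v (Y x) • ξ x

/-- `(g, Φ, ξ, η)` is a Sasaki-Einstein structure on the open set `U`: it is a Sasaki structure
whose metric is Einstein. -/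
def IsSasakiEinsteinOn (g : BilinField d M ℝ) (Φ : EndField d M) (ξ : VField d M)
    (η : OneForm d M ℝ) (U : Set M) : Prop :=
  ∃ D : AffineOp d M, IsSasakiOn g Φ ξ η D U ∧ IsEinsteinOn g D U

end Sasaki

/-! ### Basic functions and the basic Dolbeault operators -/

section Basic

/-- `φ` is a smooth basic function on the open set `U`, i.e. `ξ(φ) = 0` on `U`. -/
structure IsBasicOn (ξ : VField d M) (φ : M → ℝ) (U : Set M) : Prop where
  smooth : ContMDiffOn (𝓡 d) 𝓘(ℝ, ℝ) ∞ φ U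
  basic : ∀ x ∈ U, mvfderiv (𝓡 d) φ x (ξ x) = 0

/-- The basic form `d_B φ = dφ` of a basic function, as a complex valued one-form. -/
def dB (φ : M → ℝ) : OneForm d M ℂ := fun x ↦ Complex.ofRealCLM ∘L mvfderiv (𝓡 d) φ x

/-- `∂_B φ`: the component of type `(1,0)` of `d_B φ`. The part of type `(1,0)` of a basic one-form
`α` is `(α - i α ∘ Φ) / 2`, as `Φ` induces the transverse complex structure. -/
def delB (Φ : EndField d M) (φ : M → ℝ) : OneForm d M ℂ := fun x ↦
  (1 / 2 : ℂ) • (dB φ x - Complex.I • (dB φ x ∘L Φ x))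

/-- `∂̄_B φ`: the component of type `(0,1)` of `d_B φ`. The part of type `(0,1)` of a basic one-form
`α` is `(α + i α ∘ Φ) / 2`. -/
def delbarB (Φ : EndField d M) (φ : M → ℝ) : OneForm d M ℂ := fun x ↦
  (1 / 2 : ℂ) • (dB φ x + Complex.I • (dB φ x ∘L Φ x))

/-- `∂_B ∂̄_B φ`: the component of type `(1,1)` of the exterior derivative of the `(0,1)`-form
`∂̄_B φ`. The part of type `(1,1)` of a basic two-form `ω` is `(ω + ω(Φ ·, Φ ·)) / 2`. -/
def delDelbarB (Φ : EndField d M) (φ : M → ℝ) (x : M) (v w : TangentSpace (𝓡 d) x) : ℂ :=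
  (1 / 2 : ℂ) * (extDeriv (delbarB Φ φ) x v w + extDeriv (delbarB Φ φ) x (Φ x v) (Φ x w))

/-- `d^c_B φ = (i/2) (∂̄_B - ∂_B) φ`, which takes real values (see `ofReal_dcB`). -/
def dcB (Φ : EndField d M) (φ : M → ℝ) : OneForm d M ℝ := fun x ↦
  Complex.reCLM ∘L ((Complex.I / 2) • (delbarB Φ φ x - delB Φ φ x))

theorem ofReal_dcB (Φ : EndField d M) (φ : M → ℝ) (x : M) (v : TangentSpace (𝓡 d) x) :
    (dcB Φ φ x v : ℂ) = Complex.I / 2 * (delbarB Φ φ x v - delB Φ φ x v) := by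
  apply Complex.ext <;> simp [dcB, delB, delbarB, dB]

theorem dcB_apply (Φ : EndField d M) (φ : M → ℝ) (x : M) (v : TangentSpace (𝓡 d) x) :
    dcB Φ φ x v = -(1 / 2) * mvfderiv (𝓡 d) φ x (Φ x v) := by
  simp [dcB, delB, delbarB, dB]
  ring

end Basic

/-! ### The transverse metric and the deformation -/

section Deformation

/-- The bilinear form `dη(v, Φ w)`, the form `dη` being taken in the normalisation
`dη(X, Y) = (X(η(Y)) - Y(η(X)) - η([X, Y])) / 2`, for which it is the transverse metric of the
Sasaki structure. -/
def transverseMetric (η : OneForm d M ℝ) (Φ : EndField d M) : BilinField d M ℝ := fun x ↦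
  (1 / 2 : ℝ) • (ContinuousLinearMap.precomp ℝ (Φ x) ∘L extDeriv η x)

theorem transverseMetric_apply (η : OneForm d M ℝ) (Φ : EndField d M) (x : M)
    (v w : TangentSpace (𝓡 d) x) :
    transverseMetric η Φ x v w = 1 / 2 * extDeriv η x v (Φ x w) := by
  simp [transverseMetric]

/-- The metric `dη(Id ⊗ Φ) + η ⊗ η`. -/
def contactMetric (η : OneForm d M ℝ) (Φ : EndField d M) : BilinField d M ℝ := fun x ↦
  transverseMetric η Φ x + (η x).smulRight (η x)

theorem contactMetric_apply (η : OneForm d M ℝ) (Φ : EndField d M) (x : M)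
    (v w : TangentSpace (𝓡 d) x) :
    contactMetric η Φ x v w = 1 / 2 * extDeriv η x v (Φ x w) + η x v * η x w := by
  simp [contactMetric, transverseMetric_apply]

/-- The deformed contact form `η̃ = η + d^c_B φ`. -/
def deformedForm (Φ : EndField d M) (η : OneForm d M ℝ) (φ : M → ℝ) : OneForm d M ℝ := fun x ↦
  η x + dcB Φ φ x

/-- The deformed tensor `Φ̃ = Φ - (ξ ⊗ d^c_B φ) ∘ Φ`. -/
def deformedEnd (Φ : EndField d M) (ξ : VField d M) (φ : M → ℝ) : EndField d M := fun x ↦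
  Φ x - (dcB Φ φ x).smulRight (ξ x) ∘L Φ x

/-- The deformed metric `g̃ = dη̃(Id ⊗ Φ̃) + η̃ ⊗ η̃`. -/
def deformedMetric (Φ : EndField d M) (ξ : VField d M) (η : OneForm d M ℝ) (φ : M → ℝ) :
    BilinField d M ℝ :=
  contactMetric (deformedForm Φ η φ) (deformedEnd Φ ξ φ)

end Deformation

end SasakiEinstein

end

/-!
Put `β = d^c_B φ = -½ dφ ∘ Φ`. It vanishes on `ξ`, and it turns out to be closed on `U`. Locally
`β = df` with `f` basic, and the time-one map of the flow of `f ξ` then pulls the given structure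
back to the deformed one, since its differential is `P = Id + ξ ⊗ β` up to the flow of `ξ`, which
preserves everything. The proof below never integrates `f ξ`: it writes down the tensors that
this pullback would produce and verifies them directly.

* Closedness (`IsSasakiOn.extDeriv_dcB_eq_zero`). The equation `∂_B ∂̄_B φ = 0` says that
  `dβ + dβ(Φ·, Φ·) = 0`. On the other hand `dβ(Φ·, Φ·) = dβ`
  (`IsSasakiOn.extDeriv_dcB_end_end`), which follows by expressing `dβ` through the Hessian
  of `φ`, the formula for `∇Φ`, and `ξ(φ) = 0`.
* The metric (`IsSasakiOn.contactMetric_add_closed`). As `dη̃ = dη` and `dη` annihilates `ξ`, the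
  transverse metric does not change, and `g̃ = g(P·, P·)`.
* The connection (`IsSasakiOn.isLeviCivitaOn_shearConnection`). As `∇_ξ - L_ξ = Φ`, the pulled back
  connection is `∇̃ = P⁻¹ ∘ (∇ + β ⊗ Φ) ∘ P`. It is metric because `∇` is metric and `Φ` is skew, and
  torsion free because `β` is closed. The Sasaki equations for `Φ̃ = P⁻¹ Φ` follow
  (`IsSasakiOn.isSasakiOn_shear`).
* The curvature (`IsSasakiOn.isCurvatureOn_shearCurvature`). The curvature of `∇ + β ⊗ Φ` is
  `R(X, Y) + dβ(X, Y) Φ + β(Y) ∇_X Φ - β(X) ∇_Y Φ`. Here `dβ = 0` and `∇_X Φ = R(X, ξ)`, because `ξ`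
  is a Killing field (`IsSasakiOn.curvature_reeb_left`), so that this is `R(PX, PY)`. Hence
  `R̃ = P⁻¹ R(P·, P·) P`, and taking traces `Ric̃ = Ric(P·, P·)`, which is the same multiple of `g̃`
  as `Ric` is of `g`.
-/

noncomputable section

namespace SasakiEinstein

variable {d : ℕ} {M : Type*} [TopologicalSpace M] [ChartedSpace (EuclideanSpace ℝ (Fin d)) M]
  [IsManifold (𝓡 d) ∞ M]

/-! ### Smoothness of tensor fields, tested on vector fields -/

section Criterion

variable {F₂ : Type*} [NormedAddCommGroup F₂] [NormedSpace ℝ F₂]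
  {E₂ : M → Type*} [TopologicalSpace (TotalSpace F₂ E₂)] [∀ x, AddCommGroup (E₂ x)]
  [∀ x, Module ℝ (E₂ x)] [∀ x, TopologicalSpace (E₂ x)] [∀ x, IsTopologicalAddGroup (E₂ x)]
  [∀ x, ContinuousSMul ℝ (E₂ x)] [FiberBundle F₂ E₂] [VectorBundle ℝ F₂ E₂]

/-- A section of a bundle of homomorphisms out of the tangent bundle is smooth at a point as soon as
it maps vector fields which are smooth at this point to smooth sections; it suffices to evaluate
it on a local frame. -/
theorem contMDiffAt_hom_of_apply {A : Π x : M, TangentSpace (𝓡 d) x →L[ℝ] E₂ x} {x : M}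
    (h : ∀ X : VField d M, VSmoothAt X x → ContMDiffAt (𝓡 d) ((𝓡 d).prod 𝓘(ℝ, F₂)) ∞
      (fun y ↦ TotalSpace.mk' F₂ y (A y (X y))) x) :
    ContMDiffAt (𝓡 d) ((𝓡 d).prod 𝓘(ℝ, EuclideanSpace ℝ (Fin d) →L[ℝ] F₂)) ∞
      (fun y ↦ TotalSpace.mk' (EuclideanSpace ℝ (Fin d) →L[ℝ] F₂)
        (E := fun y : M ↦ TangentSpace (𝓡 d) y →L[ℝ] E₂ y) y (A y)) x := by
  rw [contMDiffAt_hom_bundle]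
  refine ⟨contMDiffAt_id, ?_⟩
  let b := (EuclideanSpace.basisFun (Fin d) ℝ).toBasis
  let e := trivializationAt (EuclideanSpace ℝ (Fin d)) (TangentSpace (𝓡 d) : M → Type _) x
  let e₂ := trivializationAt F₂ E₂ x
  have hx : x ∈ e.baseSet := FiberBundle.mem_baseSet_trivializationAt _ _ x
  have hx₂ : x ∈ e₂.baseSet := FiberBundle.mem_baseSet_trivializationAt _ _ x
  have hs (i) : VSmoothAt (e.localFrame b i) x := contMDiffAt_localFrame_of_mem ∞ e b i hx
  have hA (i) : ContMDiffAt (𝓡 d) 𝓘(ℝ, F₂) ∞ (fun y ↦ (e₂ ⟨y, A y (e.localFrame b i y)⟩).2) x :=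
    (contMDiffAt_totalSpace.1 (h _ (hs i))).2
  have hsum : ContMDiffAt (𝓡 d) 𝓘(ℝ, EuclideanSpace ℝ (Fin d) →L[ℝ] F₂) ∞
      (fun y ↦ ∑ i, ContinuousLinearMap.smulRightL ℝ (EuclideanSpace ℝ (Fin d)) F₂
        (LinearMap.toContinuousLinearMap (b.coord i)) (e₂ ⟨y, A y (e.localFrame b i y)⟩).2) x := by
    refine contMDiffAt_finsetSum fun i _ ↦ ?_
    exact (ContinuousLinearMap.contMDiff _).contMDiffAt.comp x (hA i)
  refine hsum.congr_of_eventuallyEq ?_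
  filter_upwards [e.open_baseSet.mem_nhds hx, e₂.open_baseSet.mem_nhds hx₂] with y hy hy₂
  rw [ContinuousLinearMap.inCoordinates_eq hy hy₂]
  apply ContinuousLinearMap.coe_injective
  refine b.ext fun j ↦ ?_
  have hbj : e.symm y (b j) = e.localFrame b j y := by
    simp [Bundle.Trivialization.localFrame_apply_of_mem_baseSet, hy, Bundle.Trivialization.basisAt]
  simp [← hbj, Finsupp.single_apply, e₂, e]

end Criterion

theorem VSmoothAt.vDiffAt {X : VField d M} {x : M} (h : VSmoothAt X x) : VDiffAt X x :=
  ContMDiffAt.mdifferentiableAt h (by simp)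

/-- Every tangent vector extends to a vector field, which allows to check tensorial identities on
vector fields. -/
theorem exists_vSmoothAt {x : M} (v : TangentSpace (𝓡 d) x) :
    ∃ X : VField d M, VSmoothAt X x ∧ X x = v :=
  ⟨FiberBundle.extend (EuclideanSpace ℝ (Fin d)) v, FiberBundle.contMDiffAt_extend .., by simp⟩

theorem VSmoothAt.add {X Y : VField d M} {x : M} (hX : VSmoothAt X x) (hY : VSmoothAt Y x) :
    VSmoothAt (fun y ↦ X y + Y y) x := ContMDiffAt.add_section hX hY

theorem VSmoothAt.smul {f : M → ℝ} {X : VField d M} {x : M}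
    (hf : ContMDiffAt (𝓡 d) 𝓘(ℝ, ℝ) ∞ f x) (hX : VSmoothAt X x) :
    VSmoothAt (fun y ↦ f y • X y) x := ContMDiffAt.smul_section hf hX

theorem VDiffAt.smul {f : M → ℝ} {X : VField d M} {x : M}
    (hf : MDifferentiableAt (𝓡 d) 𝓘(ℝ, ℝ) f x) (hX : VDiffAt X x) :
    VDiffAt (fun y ↦ f y • X y) x := MDifferentiableAt.smul_section hf hX

section
variable {F : Type*} [NormedAddCommGroup F] [NormedSpace ℝ F]

omit [IsManifold (𝓡 d) ∞ M] in
theorem contMDiffAt_section_trivial {f : M → F} {x : M} :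
    ContMDiffAt (𝓡 d) ((𝓡 d).prod 𝓘(ℝ, F)) ∞
      (fun y ↦ TotalSpace.mk' F (E := Bundle.Trivial M F) y (f y)) x ↔
    ContMDiffAt (𝓡 d) 𝓘(ℝ, F) ∞ f x := by
  rw [contMDiffAt_totalSpace]
  exact ⟨fun h ↦ h.2, fun h ↦ ⟨contMDiffAt_id, h⟩⟩

theorem formSmoothAt_iff {α : OneForm d M F} {x : M} :
    FormSmoothAt α x ↔ ∀ X : VField d M, VSmoothAt X x →
      ContMDiffAt (𝓡 d) 𝓘(ℝ, F) ∞ (fun y ↦ α y (X y)) x :=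
  ⟨fun h _ hX ↦ contMDiffAt_section_trivial.1 (ContMDiffAt.clm_bundle_apply h hX),
    fun h ↦ contMDiffAt_hom_of_apply fun X hX ↦ contMDiffAt_section_trivial.2 (h X hX)⟩

theorem FormSmoothAt.formDiffAt {α : OneForm d M F} {x : M} (h : FormSmoothAt α x) :
    FormDiffAt α x := ContMDiffAt.mdifferentiableAt h (by simp)

theorem bilinSmoothAt_iff {g : BilinField d M F} {x : M} :
    BilinSmoothAt g x ↔ ∀ X Y : VField d M, VSmoothAt X x → VSmoothAt Y x →
      ContMDiffAt (𝓡 d) 𝓘(ℝ, F) ∞ (fun y ↦ g y (X y) (Y y)) x :=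
  ⟨fun h _ Y hX hY ↦ formSmoothAt_iff.1 (ContMDiffAt.clm_bundle_apply h hX) Y hY,
    fun h ↦ contMDiffAt_hom_of_apply fun X hX ↦ formSmoothAt_iff.2 fun Y hY ↦ h X Y hX hY⟩

theorem BilinSmoothAt.formDiffAt_apply {g : BilinField d M F} {x : M} (h : BilinSmoothAt g x)
    {Y : VField d M} (hY : VDiffAt Y x) : FormDiffAt (fun y ↦ g y (Y y)) x :=
  MDifferentiableAt.clm_bundle_apply (ContMDiffAt.mdifferentiableAt h (by simp)) hY
end

theorem endSmoothAt_iff {A : EndField d M} {x : M} :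
    EndSmoothAt A x ↔ ∀ X : VField d M, VSmoothAt X x → VSmoothAt (fun y ↦ A y (X y)) x :=
  ⟨fun h _ hX ↦ ContMDiffAt.clm_bundle_apply h hX, contMDiffAt_hom_of_apply⟩

theorem EndSmoothAt.apply {A : EndField d M} {x : M} (h : EndSmoothAt A x) {X : VField d M}
    (hX : VDiffAt X x) : VDiffAt (fun y ↦ A y (X y)) x :=
  MDifferentiableAt.clm_bundle_apply (ContMDiffAt.mdifferentiableAt h (by simp)) hX

theorem formSmoothAt_mvfderiv {φ : M → ℝ} {x : M} (hφ : ContMDiffAt (𝓡 d) 𝓘(ℝ, ℝ) ∞ φ x) :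
    FormSmoothAt (fun y ↦ mvfderiv (𝓡 d) φ y) x := by
  rw [formSmoothAt_iff]
  intro X hX
  have h1 : ContMDiffAt (𝓡 d) (𝓘(ℝ, ℝ).prod 𝓘(ℝ, ℝ)) ∞ (fun y ↦ TotalSpace.mk' ℝ
      (E := (TangentSpace 𝓘(ℝ, ℝ) : ℝ → Type _)) (φ y) (mfderiv (𝓡 d) 𝓘(ℝ, ℝ) φ y (X y))) x :=
    ContMDiffAt.clm_apply_of_inCoordinates (hφ.mfderiv_const (by simp)) hX hφ
  have h2 := (contMDiffAt_totalSpace.1 h1).2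
  exact (by simpa using h2 :
    ContMDiffAt (𝓡 d) 𝓘(ℝ, ℝ) ∞ (fun y ↦ (mfderiv (𝓡 d) 𝓘(ℝ, ℝ) φ y (X y) : ℝ)) x)

/-! ### Lie brackets and second derivatives -/

omit [IsManifold (𝓡 d) ∞ M] in
theorem mvfderiv_congr {F : Type*} [NormedAddCommGroup F] [NormedSpace ℝ F] {f f' : M → F} {x : M}
    (h : f =ᶠ[𝓝 x] f') (v : TangentSpace (𝓡 d) x) :
    mvfderiv (𝓡 d) f x v = mvfderiv (𝓡 d) f' x v := by
  simp only [mvfderiv, ContinuousLinearMap.comp_apply, h.mfderiv_eq]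
  rfl

theorem VSmoothAt.eventually_vDiffAt {X : VField d M} {x : M} (h : VSmoothAt X x) :
    ∀ᶠ y in 𝓝 x, VDiffAt X y := by
  filter_upwards [(contMDiffAt_iff_contMDiffAt_nhds (n := 1) (by simp)).1
    (ContMDiffAt.of_le h (by simp))] with y hy using ContMDiffAt.mdifferentiableAt hy (by simp)

theorem eventually_mdifferentiableAt {f : M → ℝ} {x : M}
    (h : ContMDiffAt (𝓡 d) 𝓘(ℝ, ℝ) ∞ f x) :
    ∀ᶠ y in 𝓝 x, MDifferentiableAt (𝓡 d) 𝓘(ℝ, ℝ) f y := by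
  filter_upwards [(contMDiffAt_iff_contMDiffAt_nhds (n := 1) (by simp)).1
    (h.of_le (by simp))] with y hy using hy.mdifferentiableAt (by simp)

theorem VSmoothAt.lieBracket {X Y : VField d M} {x : M} (hX : VSmoothAt X x)
    (hY : VSmoothAt Y x) : VSmoothAt (VectorField.mlieBracket (𝓡 d) X Y) x := by
  have : IsManifold (𝓡 d) (minSmoothness ℝ 2) M := .of_le (n := ∞) (by
    rw [minSmoothness_of_isRCLikeNormedField]; exact WithTop.coe_le_coe.2 le_top)
  have : IsManifold (𝓡 d) (∞ + 1) M := .of_le (n := ∞) le_rfl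
  exact ContMDiffAt.mlieBracket_vectorField (m := ⊤) (n := ⊤) hX hY (by simp)

theorem VSmoothAt.leibniz_lieBracket {X Y Z : VField d M} {x : M} (hX : VSmoothAt X x)
    (hY : VSmoothAt Y x) (hZ : VSmoothAt Z x) :
    mlieBracket (𝓡 d) X (mlieBracket (𝓡 d) Y Z) x =
      mlieBracket (𝓡 d) (mlieBracket (𝓡 d) X Y) Z x +
        mlieBracket (𝓡 d) Y (mlieBracket (𝓡 d) X Z) x := by
  have h2 : minSmoothness ℝ 2 ≤ (∞ : WithTop ℕ∞) := by
    rw [minSmoothness_of_isRCLikeNormedField]; exact WithTop.coe_le_coe.2 le_top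
  have : IsManifold (𝓡 d) (minSmoothness ℝ 3) M := .of_le (n := ∞) (by
    rw [minSmoothness_of_isRCLikeNormedField]; exact WithTop.coe_le_coe.2 le_top)
  exact leibniz_identity_mlieBracket_apply (ContMDiffAt.of_le hX h2) (ContMDiffAt.of_le hY h2)
    (ContMDiffAt.of_le hZ h2)

theorem mlieBracket_mlieBracket_smul {X Y Z : VField d M} {f : M → ℝ} {x : M}
    (hY : VSmoothAt Y x) (hZ : VSmoothAt Z x)
    (hf : ContMDiffAt (𝓡 d) 𝓘(ℝ, ℝ) ∞ f x) :
    mlieBracket (𝓡 d) X (mlieBracket (𝓡 d) Y (f • Z)) x =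
      mvfderiv (𝓡 d) (fun y ↦ mvfderiv (𝓡 d) f y (Y y)) x (X x) • Z x
        + mvfderiv (𝓡 d) f x (Y x) • mlieBracket (𝓡 d) X Z x
        + mvfderiv (𝓡 d) f x (X x) • mlieBracket (𝓡 d) Y Z x
        + f x • mlieBracket (𝓡 d) X (mlieBracket (𝓡 d) Y Z) x := by
  have hYf := formSmoothAt_iff.1 (formSmoothAt_mvfderiv hf) Y hY
  have hf1 := hf.mdifferentiableAt (by simp)
  have hYf1 := hYf.mdifferentiableAt (by simp)
  have hYZ := hY.lieBracket hZ
  have hev : mlieBracket (𝓡 d) Y (f • Z) =ᶠ[𝓝 x]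
      (fun y ↦ mvfderiv (𝓡 d) f y (Y y)) • Z + f • mlieBracket (𝓡 d) Y Z := by
    filter_upwards [eventually_mdifferentiableAt hf, hZ.eventually_vDiffAt] with y h1 h2
    exact mlieBracket_smul_right h1 h2
  rw [Filter.EventuallyEq.mlieBracket_vectorField_eq (Filter.EventuallyEq.refl _ X) hev,
    mlieBracket_add_right (VSmoothAt.vDiffAt (X := (fun y ↦ mvfderiv (𝓡 d) f y (Y y)) • Z)
        (VSmoothAt.smul hYf hZ))
      (VSmoothAt.vDiffAt (X := f • mlieBracket (𝓡 d) Y Z) (VSmoothAt.smul hf hYZ)),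
    mlieBracket_smul_right hYf1 hZ.vDiffAt, mlieBracket_smul_right hf1 hYZ.vDiffAt]
  abel

/-- `[X, Y] f = X(Y f) - Y(X f)`. Both sides of the Jacobi identity for `X`, `Y`, `f Z` are expanded,
and the coefficients of a field `Z` which does not vanish at `x` are compared. -/
theorem mvfderiv_mlieBracket {X Y : VField d M} {f : M → ℝ} {x : M}
    (hX : VSmoothAt X x) (hY : VSmoothAt Y x) (hf : ContMDiffAt (𝓡 d) 𝓘(ℝ, ℝ) ∞ f x) :
    mvfderiv (𝓡 d) f x (mlieBracket (𝓡 d) X Y x) =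
      mvfderiv (𝓡 d) (fun y ↦ mvfderiv (𝓡 d) f y (Y y)) x (X x)
        - mvfderiv (𝓡 d) (fun y ↦ mvfderiv (𝓡 d) f y (X y)) x (Y x) := by
  by_cases hv : ∃ v : TangentSpace (𝓡 d) x, v ≠ 0
  · obtain ⟨v, hv⟩ := hv
    obtain ⟨Z, hZ, rfl⟩ := exists_vSmoothAt v
    have hXY := hX.lieBracket hY
    have key := hX.leibniz_lieBracket hY (VSmoothAt.smul hf hZ)
    have e1 := mlieBracket_mlieBracket_smul (X := X) hY hZ hf
    have e2 := mlieBracket_mlieBracket_smul (X := Y) hX hZ hf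
    have e3 := mlieBracket_smul_right (V := mlieBracket (𝓡 d) X Y)
      (hf.mdifferentiableAt (by simp)) hZ.vDiffAt
    have e4 := hX.leibniz_lieBracket hY hZ
    change mlieBracket (𝓡 d) X (mlieBracket (𝓡 d) Y (f • Z)) x =
      mlieBracket (𝓡 d) (mlieBracket (𝓡 d) X Y) (f • Z) x +
        mlieBracket (𝓡 d) Y (mlieBracket (𝓡 d) X (f • Z)) x at key
    rw [e1, e2, e3, e4] at key
    refine sub_eq_zero.1 ((smul_eq_zero.1 ?_).resolve_right hv)
    rw [← sub_eq_zero] at key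
    rw [← neg_eq_zero, ← key]
    module
  · push Not at hv
    simp [hv (X x), hv (Y x), hv (mlieBracket (𝓡 d) X Y x)]

/-! ### The Levi-Civita connection and its curvature -/

section LeviCivita

variable {g : BilinField d M ℝ} {D : AffineOp d M} {U : Set M} {x : M}

theorem IsLeviCivitaOn.apply_add (h : IsLeviCivitaOn g D U) (hx : x ∈ U) {Y Z : VField d M}
    (hY : VDiffAt Y x) (hZ : VDiffAt Z x) (v : TangentSpace (𝓡 d) x) :
    D (fun y ↦ Y y + Z y) x v = D Y x v + D Z x v := by
  have := h.isCovariantDerivative.add hY hZ hx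
  exact congr($this v)

theorem IsLeviCivitaOn.apply_smul (h : IsLeviCivitaOn g D U) (hx : x ∈ U) {f : M → ℝ}
    {Y : VField d M} (hf : MDifferentiableAt (𝓡 d) 𝓘(ℝ, ℝ) f x) (hY : VDiffAt Y x)
    (v : TangentSpace (𝓡 d) x) :
    D (fun y ↦ f y • Y y) x v = f x • D Y x v + mvfderiv (𝓡 d) f x v • Y x := by
  have := h.isCovariantDerivative.leibniz hY hf hx
  exact congr($this v)

theorem IsLeviCivitaOn.apply_sub (h : IsLeviCivitaOn g D U) (hx : x ∈ U) {Y Z : VField d M}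
    (hY : VDiffAt Y x) (hZ : VDiffAt Z x) (v : TangentSpace (𝓡 d) x) :
    D (fun y ↦ Y y - Z y) x v = D Y x v - D Z x v := by
  have h1 := h.isCovariantDerivative.smul_const (-1) hZ hx
  have hZ' : VDiffAt ((-1 : ℝ) • Z) x :=
    MDifferentiableAt.smul_section (mdifferentiableAt_const (c := (-1 : ℝ))) hZ
  have h2 := h.apply_add hx hY hZ' v
  rw [h1] at h2
  simpa [sub_eq_add_neg] using h2

theorem IsLeviCivitaOn.vDiffAt_apply (h : IsLeviCivitaOn g D U) (hx : x ∈ U) {Y Z : VField d M}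
    (hY : VSmoothAt Y x) (hZ : VDiffAt Z x) : VDiffAt (fun y ↦ D Y y (Z y)) x :=
  (h.smooth x hx Y hY).apply hZ

omit [IsManifold (𝓡 d) ∞ M] in
theorem mvfderiv_mul_apply {f f' : M → ℝ} (hf : MDifferentiableAt (𝓡 d) 𝓘(ℝ, ℝ) f x)
    (hf' : MDifferentiableAt (𝓡 d) 𝓘(ℝ, ℝ) f' x) (v : TangentSpace (𝓡 d) x) :
    mvfderiv (𝓡 d) (fun y ↦ f y * f' y) x v =
      f x * mvfderiv (𝓡 d) f' x v + mvfderiv (𝓡 d) f x v * f' x := by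
  rw [mvfderiv_fun_mul hf hf']
  simp [mul_comm]

end LeviCivita

section Curvature

variable {g : BilinField d M ℝ} {D : AffineOp d M} {x : M}
  {R : Π x : M, TangentSpace (𝓡 d) x →ₗ[ℝ] TangentSpace (𝓡 d) x →ₗ[ℝ]
      TangentSpace (𝓡 d) x →ₗ[ℝ] TangentSpace (𝓡 d) x} {U : Set M}

theorem IsCurvatureOn.swap (hR : IsCurvatureOn D R U) (hx : x ∈ U)
    (u v w : TangentSpace (𝓡 d) x) : R x u v w = - R x v u w := by
  obtain ⟨X, hX, rfl⟩ := exists_vSmoothAt u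
  obtain ⟨Y, hY, rfl⟩ := exists_vSmoothAt v
  obtain ⟨Z, hZ, rfl⟩ := exists_vSmoothAt w
  rw [hR x hx X Y Z hX hY hZ, hR x hx Y X Z hY hX hZ,
    mlieBracket_swap_apply (V := X) (W := Y), map_neg]
  abel

/-- The vanishing of the torsion, applied twice; summed cyclically it gives the Bianchi identity. -/
theorem IsLeviCivitaOn.lieBracket_lieBracket (hD : IsLeviCivitaOn g D U) (hU : IsOpen U)
    (hx : x ∈ U) {X Y Z : VField d M}
    (hX : VSmoothAt X x) (hY : VSmoothAt Y x) (hZ : VSmoothAt Z x) :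
    D (fun y ↦ D Z y (Y y)) x (X x) - D (fun y ↦ D Y y (Z y)) x (X x)
      - D X x (mlieBracket (𝓡 d) Y Z x) =
        mlieBracket (𝓡 d) X (mlieBracket (𝓡 d) Y Z) x := by
  have hYZ := hD.vDiffAt_apply hx hZ hY.vDiffAt
  have hZY := hD.vDiffAt_apply hx hY hZ.vDiffAt
  have hW : VDiffAt (fun y ↦ D Z y (Y y) - D Y y (Z y)) x :=
    mdifferentiableAt_sub_section hYZ hZY
  have hev : (fun y ↦ D Z y (Y y) - D Y y (Z y)) =ᶠ[𝓝 x] mlieBracket (𝓡 d) Y Z := by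
    filter_upwards [hU.mem_nhds hx, hY.eventually_vDiffAt, hZ.eventually_vDiffAt] with y h0 h1 h2
    exact hD.torsion_free y h0 Y Z h1 h2
  rw [← hD.apply_sub hx hYZ hZY, ← Filter.EventuallyEq.mlieBracket_vectorField_eq
    (Filter.EventuallyEq.refl _ X) hev, ← hD.torsion_free x hx X _ hX.vDiffAt hW,
    ← hev.self_of_nhds]

/-- The first Bianchi identity. -/
theorem IsCurvatureOn.bianchi (hR : IsCurvatureOn D R U) (hD : IsLeviCivitaOn g D U)
    (hU : IsOpen U) (hx : x ∈ U) (u v w : TangentSpace (𝓡 d) x) :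
    R x u v w + R x v w u + R x w u v = 0 := by
  obtain ⟨X, hX, rfl⟩ := exists_vSmoothAt u
  obtain ⟨Y, hY, rfl⟩ := exists_vSmoothAt v
  obtain ⟨Z, hZ, rfl⟩ := exists_vSmoothAt w
  have h1 := hD.lieBracket_lieBracket hU hx hX hY hZ
  have h2 := hD.lieBracket_lieBracket hU hx hY hZ hX
  have h3 := hD.lieBracket_lieBracket hU hx hZ hX hY
  have h4 := hX.leibniz_lieBracket hY hZ
  rw [mlieBracket_swap_apply (V := mlieBracket (𝓡 d) X Y) (W := Z)] at h4
  have h5 : mlieBracket (𝓡 d) Y (mlieBracket (𝓡 d) Z X) x =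
      - mlieBracket (𝓡 d) Y (mlieBracket (𝓡 d) X Z) x := by
    have e : mlieBracket (𝓡 d) Z X = (-1 : ℝ) • mlieBracket (𝓡 d) X Z := by
      rw [mlieBracket_swap]; simp
    rw [e, mlieBracket_const_smul_right (hX.lieBracket hZ).vDiffAt]
    simp
  rw [hR x hx X Y Z hX hY hZ, hR x hx Y Z X hY hZ hX, hR x hx Z X Y hZ hX hY]
  rw [h4] at h1
  rw [h5] at h2
  have := congr($h1 + $h2 + $h3)
  rw [← sub_eq_zero] at this
  rw [← this]
  abel

theorem IsCurvatureOn.skew (hR : IsCurvatureOn D R U) (hD : IsLeviCivitaOn g D U)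
    (hg : IsRiemannianMetricOn g U)
    (hU : IsOpen U) (hx : x ∈ U) (u v w z : TangentSpace (𝓡 d) x) :
    g x (R x u v w) z = - g x (R x u v z) w := by
  -- `[X, Y]` acts on the function `g(Z, Z)` as the commutator of `X` and `Y`.
  have key (u v w : TangentSpace (𝓡 d) x) : g x (R x u v w) w = 0 := by
    obtain ⟨X, hX, rfl⟩ := exists_vSmoothAt u
    obtain ⟨Y, hY, rfl⟩ := exists_vSmoothAt v
    obtain ⟨Z, hZ, rfl⟩ := exists_vSmoothAt w
    have hf : ContMDiffAt (𝓡 d) 𝓘(ℝ, ℝ) ∞ (fun y ↦ g y (Z y) (Z y)) x :=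
      bilinSmoothAt_iff.1 (hg.smooth x hx) Z Z hZ hZ
    have hfirst {W : VField d M} : (fun y ↦ mvfderiv (𝓡 d) (fun y ↦ g y (Z y) (Z y)) y (W y))
        =ᶠ[𝓝 x] fun y ↦ 2 * g y (D Z y (W y)) (Z y) := by
      filter_upwards [hU.mem_nhds hx, hZ.eventually_vDiffAt] with y h0 h1
      rw [hD.metric y h0 Z Z h1 h1, hg.symm y h0 (Z y)]
      ring
    have hsecond {V W : VField d M} (hW : VSmoothAt W x) :
        mvfderiv (𝓡 d) (fun y ↦ mvfderiv (𝓡 d) (fun y ↦ g y (Z y) (Z y)) y (W y)) x (V x) =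
          2 * (g x (D (fun y ↦ D Z y (W y)) x (V x)) (Z x)
            + g x (D Z x (W x)) (D Z x (V x))) := by
      have hDW := hD.vDiffAt_apply hx hZ hW.vDiffAt
      have h1 := ((hg.smooth x hx).formDiffAt_apply hDW).apply hZ.vDiffAt
      rw [mvfderiv_congr hfirst, mvfderiv_mul_apply mdifferentiableAt_const h1,
        hD.metric x hx _ _ hDW hZ.vDiffAt, mvfderiv_const]
      simp
    have h := mvfderiv_mlieBracket hX hY hf
    rw [hsecond hX, hsecond hY, hD.metric x hx Z Z hZ.vDiffAt hZ.vDiffAt,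
      hg.symm x hx (Z x)] at h
    rw [hR x hx X Y Z hX hY hZ]
    simp only [map_sub, sub_apply]
    rw [hg.symm x hx (D Z x (X x)) (D Z x (Y x))] at h
    linarith
  have h1 := key u v (w + z)
  simp only [map_add, add_apply, key] at h1
  linarith

end Curvature

namespace IsSasakiOn

variable {g : BilinField d M ℝ} {Φ : EndField d M} {ξ : VField d M} {η : OneForm d M ℝ}
  {D : AffineOp d M} {x : M} {U : Set M}

theorem apply_reeb_left (h : IsSasakiOn g Φ ξ η D U) (hx : x ∈ U) (v : TangentSpace (𝓡 d) x) :
    g x (ξ x) v = η x v := (h.η_eq x hx v).symm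

theorem apply_reeb_right (h : IsSasakiOn g Φ ξ η D U) (hx : x ∈ U) (v : TangentSpace (𝓡 d) x) :
    g x v (ξ x) = η x v := by
  rw [h.isRiemannianMetric.symm x hx, h.η_eq x hx]

theorem form_reeb (h : IsSasakiOn g Φ ξ η D U) (hx : x ∈ U) : η x (ξ x) = 1 := by
  rw [h.η_eq x hx, h.unit x hx]

theorem skew (h : IsSasakiOn g Φ ξ η D U) (hx : x ∈ U) (v w : TangentSpace (𝓡 d) x) :
    g x (Φ x v) w = - g x v (Φ x w) := by
  rw [h.Φ_eq x hx, h.Φ_eq x hx]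
  linarith [h.killing x hx v w]

theorem nondegenerate (h : IsSasakiOn g Φ ξ η D U) (hx : x ∈ U) {v w : TangentSpace (𝓡 d) x}
    (hvw : ∀ z, g x v z = g x w z) : v = w := by
  by_contra hne
  have := h.isRiemannianMetric.pos x hx (v - w) (sub_ne_zero.2 hne)
  simp [hvw] at this

/-- `η ∘ Φ = 0`, since `ξ` has constant length. -/
theorem form_end (h : IsSasakiOn g Φ ξ η D U) (hU : IsOpen U) (hx : x ∈ U)
    (v : TangentSpace (𝓡 d) x) :
    η x (Φ x v) = 0 := by
  have hξ := (h.smooth_ξ x hx).vDiffAt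
  have h1 := h.isLeviCivita.metric x hx ξ ξ hξ hξ v
  have h2 : (fun y ↦ g y (ξ y) (ξ y)) =ᶠ[𝓝 x] fun _ ↦ 1 := by
    filter_upwards [hU.mem_nhds hx] with y hy using h.unit y hy
  rw [mvfderiv_congr h2, mvfderiv_const, ← h.Φ_eq x hx, h.apply_reeb_left hx,
    h.apply_reeb_right hx] at h1
  simp at h1
  linarith

theorem end_reeb (h : IsSasakiOn g Φ ξ η D U) (hU : IsOpen U) (hx : x ∈ U) : Φ x (ξ x) = 0 := by
  refine h.nondegenerate hx fun z ↦ ?_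
  rw [h.skew hx, h.apply_reeb_left hx, h.form_end hU hx]
  simp

theorem form_deriv (h : IsSasakiOn g Φ ξ η D U) (hx : x ∈ U) {Y : VField d M}
    (hY : VDiffAt Y x) (hU : IsOpen U) (v : TangentSpace (𝓡 d) x) :
    mvfderiv (𝓡 d) (fun y ↦ η y (Y y)) x v = g x (Φ x v) (Y x) + η x (D Y x v) := by
  have h2 : (fun y ↦ η y (Y y)) =ᶠ[𝓝 x] fun y ↦ g y (ξ y) (Y y) := by
    filter_upwards [hU.mem_nhds hx] with y hy using h.η_eq y hy _
  rw [mvfderiv_congr h2, h.isLeviCivita.metric x hx ξ Y (h.smooth_ξ x hx).vDiffAt hY,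
    h.Φ_eq x hx, h.apply_reeb_left hx]

theorem extDeriv_form (h : IsSasakiOn g Φ ξ η D U) (hU : IsOpen U) (hx : x ∈ U)
    (v w : TangentSpace (𝓡 d) x) :
    extDeriv η x v w = 2 * g x (Φ x v) w := by
  obtain ⟨X, hX, rfl⟩ := exists_vSmoothAt v
  obtain ⟨Y, hY, rfl⟩ := exists_vSmoothAt w
  have hX := hX.vDiffAt
  have hY := hY.vDiffAt
  rw [extDeriv_apply (h.smooth_η x hx).formDiffAt hX hY, h.form_deriv hx hX hU,
    h.form_deriv hx hY hU, ← h.isLeviCivita.torsion_free x hx X Y hX hY,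
    h.skew hx (Y x), h.isRiemannianMetric.symm x hx (Y x), map_sub]
  ring

end IsSasakiOn

namespace IsSasakiOn

variable {g : BilinField d M ℝ} {Φ : EndField d M} {ξ : VField d M} {η : OneForm d M ℝ}
  {D : AffineOp d M} {x : M}

/-- `Φ² = -Id + η ⊗ ξ`, which is the equation for `∇Φ` evaluated on `ξ`. -/
theorem end_end (h : IsSasakiOn g Φ ξ η D Set.univ) (v : TangentSpace (𝓡 d) x) :
    Φ x (Φ x v) = - v + η x v • ξ x := by
  have hx := Set.mem_univ x
  have h1 := h.deriv_Φ x hx ξ (h.smooth_ξ x hx).vDiffAt v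
  have h2 : (fun y ↦ Φ y (ξ y)) = 0 := funext fun y ↦ h.end_reeb isOpen_univ (Set.mem_univ y)
  rw [h2, h.isLeviCivita.isCovariantDerivative.zero, ← h.Φ_eq x hx, h.unit x hx,
    h.apply_reeb_right hx] at h1
  simp only [zero_apply, zero_sub, one_smul] at h1
  rw [← neg_eq_iff_eq_neg.2 (neg_neg _).symm] at h1
  rw [← neg_neg (Φ x (Φ x v)), h1]
  abel

variable {R : Π x : M, TangentSpace (𝓡 d) x →ₗ[ℝ] TangentSpace (𝓡 d) x →ₗ[ℝ]
      TangentSpace (𝓡 d) x →ₗ[ℝ] TangentSpace (𝓡 d) x}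

/-- `R(X, Y) ξ = η(Y) X - η(X) Y`, the skew part of the equation for `∇Φ = ∇∇ξ`. -/
theorem curvature_reeb (h : IsSasakiOn g Φ ξ η D Set.univ) (hR : IsCurvatureOn D R Set.univ)
    (v w : TangentSpace (𝓡 d) x) :
    R x v w (ξ x) = η x w • v - η x v • w := by
  have hx := Set.mem_univ x
  obtain ⟨X, hX, rfl⟩ := exists_vSmoothAt v
  obtain ⟨Y, hY, rfl⟩ := exists_vSmoothAt w
  have e (W : VField d M) : (fun y ↦ D ξ y (W y)) = fun y ↦ Φ y (W y) :=
    funext fun y ↦ (h.Φ_eq y (Set.mem_univ y) _).symm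
  rw [hR x hx X Y ξ hX hY (h.smooth_ξ x hx), e, e, ← h.Φ_eq x hx,
    ← h.isLeviCivita.torsion_free x hx X Y hX.vDiffAt hY.vDiffAt, map_sub]
  have h1 := h.deriv_Φ x hx Y hY.vDiffAt (X x)
  have h2 := h.deriv_Φ x hx X hX.vDiffAt (Y x)
  rw [sub_eq_iff_eq_add] at h1 h2
  rw [h1, h2, h.apply_reeb_left hx, h.apply_reeb_left hx, h.isRiemannianMetric.symm x hx (Y x)]
  module

/-- The Killing identity `R(X, ξ) Y = (∇_X Φ) Y`, with the right hand side given by the Sasaki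
equation. -/
theorem curvature_reeb_left (h : IsSasakiOn g Φ ξ η D Set.univ)
    (hR : IsCurvatureOn D R Set.univ) (v w : TangentSpace (𝓡 d) x) :
    R x (ξ x) v w = g x v w • ξ x - η x w • v := by
  have hx := Set.mem_univ x
  -- The difference of the two sides, lowered by `g`, is symmetric in its first two arguments by
  -- the Bianchi identity and skew in the last two, hence it vanishes.
  let S (a b c : TangentSpace (𝓡 d) x) : ℝ := g x (R x (ξ x) a b - (g x a b • ξ x - η x b • a)) c
  have hsymm (a b c) : S a b c = S b a c := by
    have hb := hR.bianchi h.isLeviCivita isOpen_univ hx (ξ x) a b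
    rw [hR.swap hx b (ξ x) a, h.curvature_reeb hR] at hb
    have hb' : R x (ξ x) a b = R x (ξ x) b a - (η x b • a - η x a • b) := by
      rw [← sub_eq_zero, ← hb]; abel
    simp only [S, hb', h.isRiemannianMetric.symm x hx b a]
    congr 2
    abel
  have hskew (a b c) : S a b c = - S a c b := by
    have hs := hR.skew h.isLeviCivita h.isRiemannianMetric isOpen_univ hx (ξ x) a b c
    simp only [S, map_sub, map_smul, sub_apply,
      smul_apply, smul_eq_mul, hs, h.apply_reeb_left hx]
    ring
  refine sub_eq_zero.1 (h.nondegenerate hx fun z ↦ ?_)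
  have : S v w z = 0 := by
    linarith [hsymm v w z, hskew w v z, hsymm w z v, hskew z w v, hsymm z v w, hskew v z w]
  simpa [S] using this

end IsSasakiOn

/-! ### Closedness of the form `d^c_B φ` -/

theorem extDeriv_clm_comp {F F' : Type*} [NormedAddCommGroup F] [NormedSpace ℝ F]
    [NormedAddCommGroup F'] [NormedSpace ℝ F'] (L : F →L[ℝ] F') {α : OneForm d M F} {x : M}
    (hα : FormSmoothAt α x) (v w : TangentSpace (𝓡 d) x) :
    extDeriv (fun y ↦ L ∘L α y) x v w = L (extDeriv α x v w) := by
  obtain ⟨X, hX, rfl⟩ := exists_vSmoothAt v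
  obtain ⟨Y, hY, rfl⟩ := exists_vSmoothAt w
  have hLα : FormSmoothAt (fun y ↦ L ∘L α y) x := formSmoothAt_iff.2 fun Z hZ ↦
    L.contMDiff.contMDiffAt.comp x (formSmoothAt_iff.1 hα Z hZ)
  have key {Z : VField d M} (hZ : VDiffAt Z x) (v : TangentSpace (𝓡 d) x) :
      mvfderiv (𝓡 d) (fun y ↦ (L ∘L α y) (Z y)) x v =
        L (mvfderiv (𝓡 d) (fun y ↦ α y (Z y)) x v) := by
    have h1 := (L.hasMFDerivAt.comp x (hα.formDiffAt.apply hZ).hasMFDerivAt).mfderiv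
    exact congr($h1 v)
  rw [extDeriv_apply hLα.formDiffAt hX.vDiffAt hY.vDiffAt,
    extDeriv_apply hα.formDiffAt hX.vDiffAt hY.vDiffAt, key hX.vDiffAt, key hY.vDiffAt]
  simp

section Hessian

variable {g : BilinField d M ℝ} {D : AffineOp d M} {U : Set M} {x : M} {φ : M → ℝ}

/-- The Hessian `X(Y φ) - (∇_X Y) φ` of a function, in the direction `v = X(x)` and along the
vector field `Y`. -/
def hessian (D : AffineOp d M) (φ : M → ℝ) (x : M) (v : TangentSpace (𝓡 d) x) (Y : VField d M) :
    ℝ :=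
  mvfderiv (𝓡 d) (fun y ↦ mvfderiv (𝓡 d) φ y (Y y)) x v - mvfderiv (𝓡 d) φ x (D Y x v)

theorem hessian_symm (hD : IsLeviCivitaOn g D U) (hx : x ∈ U)
    (hφ : ContMDiffAt (𝓡 d) 𝓘(ℝ, ℝ) ∞ φ x) {X Y : VField d M} (hX : VSmoothAt X x)
    (hY : VSmoothAt Y x) : hessian D φ x (X x) Y = hessian D φ x (Y x) X := by
  have h1 := mvfderiv_mlieBracket hX hY hφ
  rw [← hD.torsion_free x hx X Y hX.vDiffAt hY.vDiffAt, map_sub] at h1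
  simp only [hessian]
  linarith

theorem formSmoothAt_delbarB {Φ : EndField d M} (hφ : ContMDiffAt (𝓡 d) 𝓘(ℝ, ℝ) ∞ φ x)
    (hΦ : EndSmoothAt Φ x) : FormSmoothAt (delbarB Φ φ) x := by
  refine formSmoothAt_iff.2 fun X hX ↦ ?_
  have h1 := formSmoothAt_iff.1 (formSmoothAt_mvfderiv hφ) X hX
  have h2 := formSmoothAt_iff.1 (formSmoothAt_mvfderiv hφ) _ (endSmoothAt_iff.1 hΦ X hX)
  have hI := ((Complex.I / 2) • Complex.ofRealCLM).contMDiff (n := ∞)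
  have hH := ((1 / 2 : ℂ) • Complex.ofRealCLM).contMDiff (n := ∞)
  refine ((hH.contMDiffAt.comp x h1).add (hI.contMDiffAt.comp x h2)).congr_of_eventuallyEq
    (.of_forall fun y ↦ ?_)
  simp [delbarB, dB]
  ring

/-- `d^c_B φ` is minus the imaginary part of `∂̄_B φ`. -/
theorem dcB_eq_neg_im_comp_delbarB (Φ : EndField d M) (φ : M → ℝ) :
    dcB Φ φ = fun y ↦ (-Complex.imCLM) ∘L delbarB Φ φ y := by
  ext y v
  rw [dcB_apply]
  simp [delbarB, dB]

theorem formSmoothAt_dcB {Φ : EndField d M} (hφ : ContMDiffAt (𝓡 d) 𝓘(ℝ, ℝ) ∞ φ x)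
    (hΦ : EndSmoothAt Φ x) : FormSmoothAt (dcB Φ φ) x := by
  rw [dcB_eq_neg_im_comp_delbarB]
  exact formSmoothAt_iff.2 fun Z hZ ↦ (-Complex.imCLM).contMDiff.contMDiffAt.comp x
    (formSmoothAt_iff.1 (formSmoothAt_delbarB hφ hΦ) Z hZ)

end Hessian

section Closed

variable {g : BilinField d M ℝ} {Φ : EndField d M} {ξ : VField d M} {η : OneForm d M ℝ}
  {D : AffineOp d M} {x : M} {U : Set M} {φ : M → ℝ}

theorem IsSasakiOn.dcB_reeb (h : IsSasakiOn g Φ ξ η D Set.univ) (x : M) :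
    dcB Φ φ x (ξ x) = 0 := by
  rw [dcB_apply, h.end_reeb isOpen_univ (Set.mem_univ x)]
  simp

/-- The exterior derivative of `d^c_B φ`, expressed through the Hessian of `φ` and the Sasaki equation
for `∇Φ`. -/
theorem IsSasakiOn.extDeriv_dcB (h : IsSasakiOn g Φ ξ η D Set.univ) (hU : IsOpen U)
    (hφ : IsBasicOn ξ φ U) (hx : x ∈ U) {X Y : VField d M} (hX : VSmoothAt X x)
    (hY : VSmoothAt Y x) :
    extDeriv (dcB Φ φ) x (X x) (Y x) = -(1 / 2) * (
      hessian D φ x (X x) (fun y ↦ Φ y (Y y)) - hessian D φ x (Y x) (fun y ↦ Φ y (X y))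
        + η x (Y x) * mvfderiv (𝓡 d) φ x (X x) - η x (X x) * mvfderiv (𝓡 d) φ x (Y x)) := by
  have hx' := Set.mem_univ x
  have hφx := hφ.smooth.contMDiffAt (hU.mem_nhds hx)
  have hΦ := h.smooth_Φ x hx'
  have key {Z : VField d M} (hZ : VSmoothAt Z x) (v : TangentSpace (𝓡 d) x) :
      mvfderiv (𝓡 d) (fun y ↦ dcB Φ φ y (Z y)) x v = -(1 / 2) * (
        hessian D φ x v (fun y ↦ Φ y (Z y)) + mvfderiv (𝓡 d) φ x (Φ x (D Z x v))
          + η x (Z x) * mvfderiv (𝓡 d) φ x v) := by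
    have hd := formSmoothAt_iff.1 (formSmoothAt_mvfderiv hφx) _ (endSmoothAt_iff.1 hΦ Z hZ)
    have h1 := h.deriv_Φ x hx' Z hZ.vDiffAt v
    rw [sub_eq_iff_eq_add] at h1
    simp only [dcB_apply]
    rw [mvfderiv_mul_apply mdifferentiableAt_const (hd.mdifferentiableAt (by simp)),
      mvfderiv_const, hessian, h1]
    simp only [map_add, map_sub, map_smul, hφ.basic x hx, h.apply_reeb_left hx', smul_eq_mul,
      zero_apply]
    ring
  rw [extDeriv_apply (formSmoothAt_dcB hφx hΦ).formDiffAt hX.vDiffAt hY.vDiffAt, key hX, key hY,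
    dcB_apply, ← h.isLeviCivita.torsion_free x hx' X Y hX.vDiffAt hY.vDiffAt]
  simp only [map_sub]
  ring

/-- The form `d d^c_B φ` is of type `(1,1)`. Besides the symmetry of the Hessian, this uses that the
Hessian of a basic function satisfies `Hess φ (ξ, Y) = -dφ(Φ Y)`. -/
theorem IsSasakiOn.extDeriv_dcB_end_end (h : IsSasakiOn g Φ ξ η D Set.univ) (hU : IsOpen U)
    (hφ : IsBasicOn ξ φ U) (hx : x ∈ U) (v w : TangentSpace (𝓡 d) x) :
    extDeriv (dcB Φ φ) x (Φ x v) (Φ x w) = extDeriv (dcB Φ φ) x v w := by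
  obtain ⟨X, hX, rfl⟩ := exists_vSmoothAt v
  obtain ⟨Y, hY, rfl⟩ := exists_vSmoothAt w
  have hx' := Set.mem_univ x
  have hφx := hφ.smooth.contMDiffAt (hU.mem_nhds hx)
  have hΦ := endSmoothAt_iff.1 (h.smooth_Φ x hx')
  have key {V W : VField d M} (hV : VSmoothAt V x) (hW : VSmoothAt W x) :
      hessian D φ x (Φ x (V x)) (fun y ↦ Φ y (Φ y (W y))) =
        - hessian D φ x (W x) (fun y ↦ Φ y (V y))
          + η x (W x) * mvfderiv (𝓡 d) φ x (V x) := by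
    have hξ : hessian D φ x (ξ x) (fun y ↦ Φ y (V y)) = mvfderiv (𝓡 d) φ x (V x) := by
      rw [hessian_symm h.isLeviCivita hx' hφx (h.smooth_ξ x hx') (hΦ V hV), hessian,
        mvfderiv_congr (f' := fun _ ↦ (0 : ℝ)), mvfderiv_const, ← h.Φ_eq x hx', h.end_end]
      · simp [hφ.basic x hx]
      · filter_upwards [hU.mem_nhds hx] with y hy using hφ.basic y hy
    rw [hessian_symm h.isLeviCivita hx' hφx (hΦ V hV) (hΦ _ (hΦ W hW)), h.end_end, ← hξ]
    simp only [hessian, map_add, map_neg, map_smul, smul_eq_mul]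
    ring
  rw [h.extDeriv_dcB hU hφ hx (hΦ X hX) (hΦ Y hY), h.extDeriv_dcB hU hφ hx hX hY, key hX hY,
    key hY hX, h.form_end isOpen_univ hx', h.form_end isOpen_univ hx']
  ring

theorem IsSasakiOn.extDeriv_dcB_eq_zero (h : IsSasakiOn g Φ ξ η D Set.univ) (hU : IsOpen U)
    (hφ : IsBasicOn ξ φ U) (hx : x ∈ U)
    (hdd : ∀ v w : TangentSpace (𝓡 d) x, delDelbarB Φ φ x v w = 0) :
    extDeriv (dcB Φ φ) x = 0 := by
  have hx' := Set.mem_univ x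
  have hφx := hφ.smooth.contMDiffAt (hU.mem_nhds hx)
  have key (v w : TangentSpace (𝓡 d) x) :
      extDeriv (dcB Φ φ) x v w = -(extDeriv (delbarB Φ φ) x v w).im := by
    rw [dcB_eq_neg_im_comp_delbarB,
      extDeriv_clm_comp _ (formSmoothAt_delbarB hφx (h.smooth_Φ x hx'))]
    simp
  ext v w
  have h1 := congr(Complex.im $(hdd v w))
  have h2 := h.extDeriv_dcB_end_end hU hφ hx v w
  rw [key, key] at h2
  rw [key]
  simp [delDelbarB] at h1 ⊢
  linarith

end Closed

/-! ### The shear along the Reeb field -/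

/-- The endomorphism field `P = Id + ξ ⊗ β`. -/
def shear (ξ : VField d M) (β : OneForm d M ℝ) : EndField d M := fun x ↦
  ContinuousLinearMap.id ℝ _ + (β x).smulRight (ξ x)

/-- The endomorphism field `Id - ξ ⊗ β`, inverse to `shear ξ β` if `β(ξ) = 0`. -/
def unshear (ξ : VField d M) (β : OneForm d M ℝ) : EndField d M := fun x ↦
  ContinuousLinearMap.id ℝ _ - (β x).smulRight (ξ x)

/-- The connection `P⁻¹ ∘ (∇ + β ⊗ Φ) ∘ P` with `P = Id + ξ ⊗ β`, that is
`v ↦ P⁻¹ (∇_v (P Y) + β(v) Φ Y)`; note that `Φ P = Φ`, as `Φ ξ = 0`. -/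
def shearConnection (Φ : EndField d M) (ξ : VField d M) (β : OneForm d M ℝ) (D : AffineOp d M) :
    AffineOp d M := fun Y x ↦
  unshear ξ β x ∘L (D (fun y ↦ shear ξ β y (Y y)) x + (β x).smulRight (Φ x (Y x)))

/-- The tensor `(u, v, w) ↦ P⁻¹ R(P u, P v) P w` with `P = Id + ξ ⊗ β`. -/
def shearCurvature (ξ : VField d M) (β : OneForm d M ℝ)
    (R : Π x : M, TangentSpace (𝓡 d) x →ₗ[ℝ] TangentSpace (𝓡 d) x →ₗ[ℝ]
      TangentSpace (𝓡 d) x →ₗ[ℝ] TangentSpace (𝓡 d) x) (x : M) :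
    TangentSpace (𝓡 d) x →ₗ[ℝ] TangentSpace (𝓡 d) x →ₗ[ℝ]
      TangentSpace (𝓡 d) x →ₗ[ℝ] TangentSpace (𝓡 d) x :=
  ((R x).compl₁₂ (shear ξ β x).toLinearMap (shear ξ β x).toLinearMap).compr₂
    (LinearMap.compRight ℝ (unshear ξ β x).toLinearMap ∘ₗ
      LinearMap.lcomp ℝ _ (shear ξ β x).toLinearMap)

section Algebra

variable {ξ : VField d M} {β : OneForm d M ℝ} {x : M}

omit [IsManifold (𝓡 d) ∞ M]

theorem shear_apply (v : TangentSpace (𝓡 d) x) : shear ξ β x v = v + β x v • ξ x := by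
  simp [shear]

theorem unshear_apply (v : TangentSpace (𝓡 d) x) : unshear ξ β x v = v - β x v • ξ x := by
  simp [unshear]

theorem shear_unshear (h : β x (ξ x) = 0) (v : TangentSpace (𝓡 d) x) :
    shear ξ β x (unshear ξ β x v) = v := by
  simp [shear_apply, unshear_apply, h]

theorem unshear_shear (h : β x (ξ x) = 0) (v : TangentSpace (𝓡 d) x) :
    unshear ξ β x (shear ξ β x v) = v := by
  simp [shear_apply, unshear_apply, h]

theorem shear_reeb (h : β x (ξ x) = 0) : shear ξ β x (ξ x) = ξ x := by
  simp [shear_apply, h]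

theorem unshear_reeb (h : β x (ξ x) = 0) : unshear ξ β x (ξ x) = ξ x := by
  simp [unshear_apply, h]

theorem shearConnection_apply (Φ : EndField d M) (D : AffineOp d M) (Y : VField d M)
    (v : TangentSpace (𝓡 d) x) :
    shearConnection Φ ξ β D Y x v =
      unshear ξ β x (D (fun y ↦ shear ξ β y (Y y)) x v + β x v • Φ x (Y x)) := by
  simp [shearConnection]

theorem shearCurvature_apply (R : Π x : M, TangentSpace (𝓡 d) x →ₗ[ℝ] TangentSpace (𝓡 d) x →ₗ[ℝ]
      TangentSpace (𝓡 d) x →ₗ[ℝ] TangentSpace (𝓡 d) x) (u v w : TangentSpace (𝓡 d) x) :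
    shearCurvature ξ β R x u v w =
      unshear ξ β x (R x (shear ξ β x u) (shear ξ β x v) (shear ξ β x w)) := by
  simp [shearCurvature]

theorem ricci_shearCurvature (h : β x (ξ x) = 0)
    (R : Π x : M, TangentSpace (𝓡 d) x →ₗ[ℝ] TangentSpace (𝓡 d) x →ₗ[ℝ]
      TangentSpace (𝓡 d) x →ₗ[ℝ] TangentSpace (𝓡 d) x) (v w : TangentSpace (𝓡 d) x) :
    ricci (shearCurvature ξ β R x) v w = ricci (R x) (shear ξ β x v) (shear ξ β x w) := by
  -- The trace of `u ↦ P⁻¹ R(P u, P v) P w` is that of its conjugate `u ↦ R(u, P v) P w`.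
  let A := ((R x).flip (shear ξ β x v)).flip (shear ξ β x w)
  have h1 : ((shearCurvature ξ β R x).flip v).flip w =
      (unshear ξ β x).toLinearMap * (A * (shear ξ β x).toLinearMap) := by
    ext u
    simp [shearCurvature_apply, A]
  have h2 : (shear ξ β x).toLinearMap * (unshear ξ β x).toLinearMap = 1 :=
    LinearMap.ext fun u ↦ shear_unshear h u
  rw [ricci, h1, LinearMap.trace_mul_comm, mul_assoc, h2, mul_one]
  rfl

end Algebra

section Smooth

variable {ξ : VField d M} {β : OneForm d M ℝ} {x : M}

theorem VSmoothAt.shear {Y : VField d M} (hY : VSmoothAt Y x) (hξ : VSmoothAt ξ x)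
    (hβ : FormSmoothAt β x) : VSmoothAt (fun y ↦ shear ξ β y (Y y)) x := by
  simp only [shear_apply]
  exact hY.add (VSmoothAt.smul (formSmoothAt_iff.1 hβ Y hY) hξ)

theorem VSmoothAt.unshear {Y : VField d M} (hY : VSmoothAt Y x) (hξ : VSmoothAt ξ x)
    (hβ : FormSmoothAt β x) : VSmoothAt (fun y ↦ unshear ξ β y (Y y)) x := by
  simp only [unshear_apply]
  exact ContMDiffAt.sub_section hY (VSmoothAt.smul (formSmoothAt_iff.1 hβ Y hY) hξ)

theorem endSmoothAt_shear (hξ : VSmoothAt ξ x) (hβ : FormSmoothAt β x) :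
    EndSmoothAt (shear ξ β) x := endSmoothAt_iff.2 fun _ hX ↦ hX.shear hξ hβ

end Smooth

section Deformation

variable {g g' : BilinField d M ℝ} {Φ Φ' : EndField d M} {ξ : VField d M} {η : OneForm d M ℝ}
  {D : AffineOp d M} {x : M} {U : Set M} {β : OneForm d M ℝ}

theorem IsSasakiOn.end_shear (h : IsSasakiOn g Φ ξ η D Set.univ) (v : TangentSpace (𝓡 d) x) :
    Φ x (shear ξ β x v) = Φ x v := by
  simp [shear_apply, h.end_reeb isOpen_univ (Set.mem_univ x)]

theorem IsSasakiOn.end_unshear (h : IsSasakiOn g Φ ξ η D Set.univ) (v : TangentSpace (𝓡 d) x) :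
    Φ x (unshear ξ β x v) = Φ x v := by
  simp [unshear_apply, h.end_reeb isOpen_univ (Set.mem_univ x)]

theorem IsSasakiOn.form_shear (h : IsSasakiOn g Φ ξ η D Set.univ) (v : TangentSpace (𝓡 d) x) :
    η x (shear ξ β x v) = η x v + β x v := by
  simp [shear_apply, h.form_reeb (Set.mem_univ x)]

theorem mvfderiv_sub_mvfderiv_of_closed (hβ : FormSmoothAt β x) (hd : extDeriv β x = 0)
    {X Y : VField d M} (hX : VDiffAt X x) (hY : VDiffAt Y x) :
    β x (mlieBracket (𝓡 d) X Y x) =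
      mvfderiv (𝓡 d) (fun y ↦ β y (Y y)) x (X x) - mvfderiv (𝓡 d) (fun y ↦ β y (X y)) x (Y x) := by
  have := extDeriv_apply hβ.formDiffAt hX hY
  rw [hd] at this
  simp only [zero_apply] at this
  linarith

/-- The closedness of `β` is needed for the vanishing of the torsion, and the skewness of `Φ` for the
compatibility with the metric. -/
theorem IsSasakiOn.isLeviCivitaOn_shearConnection (h : IsSasakiOn g Φ ξ η D Set.univ)
    (hU : IsOpen U) (hβ : ∀ x ∈ U, FormSmoothAt β x) (hβξ : ∀ x, β x (ξ x) = 0)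
    (hd : ∀ x ∈ U, extDeriv β x = 0)
    (hg : ∀ x ∈ U, ∀ v w, g' x v w = g x (shear ξ β x v) (shear ξ β x w)) :
    IsLeviCivitaOn g' (shearConnection Φ ξ β D) U where
  isCovariantDerivative :=
    { add := fun {Y Z x} hY hZ hx ↦ by
        have hx' := Set.mem_univ x
        have hP := endSmoothAt_shear (h.smooth_ξ x hx') (hβ x hx)
        ext1 v
        have := h.isLeviCivita.apply_add hx' (hP.apply hY) (hP.apply hZ) v
        simp only [shearConnection_apply, add_apply, Pi.add_apply, map_add, smul_add, this]
        abel
      leibniz := fun {Y f x} hY hf hx ↦ by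
        have hx' := Set.mem_univ x
        have hP := endSmoothAt_shear (h.smooth_ξ x hx') (hβ x hx)
        ext1 v
        have := h.isLeviCivita.apply_smul hx' hf (hP.apply hY) v
        simp only [shearConnection_apply, add_apply, Pi.smul_apply', map_add, map_smul, this,
          smul_apply, ContinuousLinearMap.smulRight_apply, unshear_shear (hβξ x)]
        module }
  smooth x hx Y hY := by
    have hx' := Set.mem_univ x
    have hξ := h.smooth_ξ x hx'
    refine endSmoothAt_iff.2 fun X hX ↦ ?_
    simp only [shearConnection_apply]
    have h1 := endSmoothAt_iff.1 (h.isLeviCivita.smooth x hx' _ (hY.shear hξ (hβ x hx))) X hX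
    have h2 := endSmoothAt_iff.1 (h.smooth_Φ x hx') Y hY
    exact (h1.add (VSmoothAt.smul (formSmoothAt_iff.1 (hβ x hx) X hX) h2)).unshear hξ (hβ x hx)
  torsion_free x hx X Y hX hY := by
    have hx' := Set.mem_univ x
    have hξ := (h.smooth_ξ x hx').vDiffAt
    have key {Z : VField d M} (hZ : VDiffAt Z x) (v : TangentSpace (𝓡 d) x) :
        D (fun y ↦ shear ξ β y (Z y)) x v = D Z x v + (β x (Z x) • Φ x v
          + mvfderiv (𝓡 d) (fun y ↦ β y (Z y)) x v • ξ x) := by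
      have hβZ := (hβ x hx).formDiffAt.apply hZ
      simp only [shear_apply]
      rw [h.isLeviCivita.apply_add hx' hZ (VDiffAt.smul hβZ hξ),
        h.isLeviCivita.apply_smul hx' hβZ hξ, h.Φ_eq x hx']
    rw [shearConnection_apply, shearConnection_apply, ← map_sub, key hX, key hY]
    have h1 := h.isLeviCivita.torsion_free x hx' X Y hX hY
    have h2 := mvfderiv_sub_mvfderiv_of_closed (hβ x hx) (hd x hx) hX hY
    rw [← unshear_shear (hβξ x) (mlieBracket (𝓡 d) X Y x), shear_apply, h2, ← h1]
    congr 1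
    module
  metric x hx Y Z hY hZ v := by
    have hx' := Set.mem_univ x
    have hP := endSmoothAt_shear (h.smooth_ξ x hx') (hβ x hx)
    have hev : (fun y ↦ g' y (Y y) (Z y)) =ᶠ[𝓝 x]
        fun y ↦ g y (shear ξ β y (Y y)) (shear ξ β y (Z y)) := by
      filter_upwards [hU.mem_nhds hx] with y hy using hg y hy _ _
    rw [mvfderiv_congr hev, h.isLeviCivita.metric x hx' _ _ (hP.apply hY) (hP.apply hZ), hg x hx,
      hg x hx, shearConnection_apply, shearConnection_apply, shear_unshear (hβξ x),
      shear_unshear (hβξ x), ← h.end_shear (β := β) (Y x), ← h.end_shear (β := β) (Z x)]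
    have := h.skew hx' (shear ξ β x (Y x)) (shear ξ β x (Z x))
    simp only [map_add, map_smul, add_apply, smul_apply, smul_eq_mul, this]
    ring

/-- The shear of a Sasaki structure by a closed one-form `β` with `β(ξ) = 0` is a Sasaki structure.
Since `β(ξ) = 0` holds on the whole manifold, so does `P P⁻¹ = Id`, and the vector fields to which
`∇` is applied can be rewritten globally; the metric is only known on `U`. -/
theorem IsSasakiOn.isSasakiOn_shear (h : IsSasakiOn g Φ ξ η D Set.univ)
    (hU : IsOpen U) (hβ : ∀ x ∈ U, FormSmoothAt β x) (hβξ : ∀ x, β x (ξ x) = 0)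
    (hd : ∀ x ∈ U, extDeriv β x = 0)
    (hg : ∀ x ∈ U, ∀ v w, g' x v w = g x (shear ξ β x v) (shear ξ β x w))
    (hΦ' : ∀ x v, Φ' x v = unshear ξ β x (Φ x v)) :
    IsSasakiOn g' Φ' ξ (fun x ↦ η x + β x) (shearConnection Φ ξ β D) U := by
  have hDξ (x : M) (v : TangentSpace (𝓡 d) x) :
      shearConnection Φ ξ β D ξ x v = unshear ξ β x (Φ x v) := by
    have e : (fun y ↦ shear ξ β y (ξ y)) = ξ := funext fun y ↦ shear_reeb (hβξ y)
    rw [shearConnection_apply, e, h.end_reeb isOpen_univ (Set.mem_univ x),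
      ← h.Φ_eq x (Set.mem_univ x)]
    simp
  refine
  { isRiemannianMetric :=
      { smooth := fun x hx ↦ ?_
        symm := fun x hx v w ↦ ?_
        pos := fun x hx v hv ↦ ?_ }
    isLeviCivita := h.isLeviCivitaOn_shearConnection hU hβ hβξ hd hg
    smooth_Φ := fun x hx ↦ endSmoothAt_iff.2 fun X hX ↦ ?_
    smooth_ξ := fun x _ ↦ h.smooth_ξ x (Set.mem_univ x)
    smooth_η := fun x hx ↦ formSmoothAt_iff.2 fun X hX ↦ ?_
    unit := fun x hx ↦ ?_
    killing := fun x hx v w ↦ ?_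
    η_eq := fun x hx v ↦ ?_
    Φ_eq := fun x _ v ↦ by rw [hDξ, hΦ']
    deriv_Φ := fun x hx Y hY v ↦ ?_ }
  all_goals have hx' := Set.mem_univ x
  · refine bilinSmoothAt_iff.2 fun X Y hX hY ↦ ?_
    have hξ := h.smooth_ξ x hx'
    refine (bilinSmoothAt_iff.1 (h.isRiemannianMetric.smooth x hx') _ _ (hX.shear hξ (hβ x hx))
      (hY.shear hξ (hβ x hx))).congr_of_eventuallyEq ?_
    filter_upwards [hU.mem_nhds hx] with y hy using hg y hy _ _
  · rw [hg x hx, hg x hx, h.isRiemannianMetric.symm x hx']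
  · rw [hg x hx]
    refine h.isRiemannianMetric.pos x hx' _ fun h0 ↦ hv ?_
    rw [← unshear_shear (hβξ x) v, h0, map_zero]
  · simp only [hΦ']
    exact (endSmoothAt_iff.1 (h.smooth_Φ x hx') X hX).unshear (h.smooth_ξ x hx') (hβ x hx)
  · exact (formSmoothAt_iff.1 (h.smooth_η x hx') X hX).add (formSmoothAt_iff.1 (hβ x hx) X hX)
  · rw [hg x hx, shear_reeb (hβξ x), h.unit x hx']
  · rw [hDξ, hDξ, hg x hx, hg x hx, shear_unshear (hβξ x), shear_unshear (hβξ x),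
      ← h.end_shear (β := β) v, h.skew hx', h.end_shear, neg_add_cancel]
  · rw [hg x hx, shear_reeb (hβξ x), h.apply_reeb_left hx', h.form_shear, add_apply]
  · have hP := endSmoothAt_shear (h.smooth_ξ x hx') (hβ x hx)
    have e : (fun y ↦ shear ξ β y (Φ' y (Y y))) = fun y ↦ Φ y (shear ξ β y (Y y)) :=
      funext fun y ↦ by rw [hΦ', shear_unshear (hβξ y), h.end_shear]
    have h1 := h.deriv_Φ x hx' _ (hP.apply hY) v
    rw [sub_eq_iff_eq_add] at h1
    rw [shearConnection_apply, e, hΦ', hΦ', h.end_unshear, shearConnection_apply, h.end_unshear,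
      h1, hg x hx, hg x hx, shear_reeb (hβξ x), ← map_sub, shear_apply v]
    simp only [map_add, map_sub, map_smul, add_apply, smul_apply, unshear_reeb (hβξ x),
      unshear_apply v, smul_eq_mul]
    module

/-- The curvature of `P⁻¹ ∘ (∇ + β ⊗ Φ) ∘ P` is `P⁻¹ R(P·, P·) P`. The terms of `R(P X, P Y)` which are
linear in `β` match those with `∇Φ` in the curvature of `∇ + β ⊗ Φ`, by the Killing identity. -/
theorem IsSasakiOn.isCurvatureOn_shearCurvature (h : IsSasakiOn g Φ ξ η D Set.univ)
    {R : Π x : M, TangentSpace (𝓡 d) x →ₗ[ℝ] TangentSpace (𝓡 d) x →ₗ[ℝ]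
      TangentSpace (𝓡 d) x →ₗ[ℝ] TangentSpace (𝓡 d) x} (hR : IsCurvatureOn D R Set.univ)
    (hβ : ∀ x ∈ U, FormSmoothAt β x) (hβξ : ∀ x, β x (ξ x) = 0)
    (hd : ∀ x ∈ U, extDeriv β x = 0) :
    IsCurvatureOn (shearConnection Φ ξ β D) (shearCurvature ξ β R) U := by
  intro x hx X Y Z hX hY hZ
  have hx' := Set.mem_univ x
  have hPZ := hZ.shear (h.smooth_ξ x hx') (hβ x hx)
  have hΦZ := endSmoothAt_iff.1 (h.smooth_Φ x hx') Z hZ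
  have hDΦ (v : TangentSpace (𝓡 d) x) : D (fun y ↦ Φ y (Z y)) x v =
      η x (shear ξ β x (Z x)) • v - g x v (shear ξ β x (Z x)) • ξ x
        + Φ x (D (fun y ↦ shear ξ β y (Z y)) x v) := by
    have e : (fun y ↦ Φ y (Z y)) = fun y ↦ Φ y (shear ξ β y (Z y)) :=
      funext fun y ↦ (h.end_shear _).symm
    rw [e, ← h.apply_reeb_left hx', ← sub_eq_iff_eq_add]
    exact h.deriv_Φ x hx' _ hPZ.vDiffAt v
  have key {V W : VField d M} (hV : VSmoothAt V x) (hW : VSmoothAt W x) :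
      shearConnection Φ ξ β D (fun y ↦ shearConnection Φ ξ β D Z y (W y)) x (V x) =
        unshear ξ β x (D (fun y ↦ D (fun y ↦ shear ξ β y (Z y)) y (W y)) x (V x)
          + (β x (W x) • D (fun y ↦ Φ y (Z y)) x (V x)
            + mvfderiv (𝓡 d) (fun y ↦ β y (W y)) x (V x) • Φ x (Z x))
          + β x (V x) • Φ x (D (fun y ↦ shear ξ β y (Z y)) x (W x) + β x (W x) • Φ x (Z x))) := by
    have e : (fun y ↦ shear ξ β y (shearConnection Φ ξ β D Z y (W y))) = fun y ↦
        D (fun y ↦ shear ξ β y (Z y)) y (W y) + β y (W y) • Φ y (Z y) :=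
      funext fun y ↦ by rw [shearConnection_apply, shear_unshear (hβξ y)]
    have hβW := (hβ x hx).formDiffAt.apply hW.vDiffAt
    rw [shearConnection_apply, e, shearConnection_apply, h.end_unshear,
      h.isLeviCivita.apply_add hx' (h.isLeviCivita.vDiffAt_apply hx' hPZ hW.vDiffAt)
        (VDiffAt.smul hβW hΦZ.vDiffAt),
      h.isLeviCivita.apply_smul hx' hβW hΦZ.vDiffAt]
  have hclosed := mvfderiv_sub_mvfderiv_of_closed (hβ x hx) (hd x hx) hX.vDiffAt hY.vDiffAt
  -- `R(P X, P Y)`, with the Killing identity inserted.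
  have hRP : R x (shear ξ β x (X x)) (shear ξ β x (Y x)) (shear ξ β x (Z x)) =
      R x (X x) (Y x) (shear ξ β x (Z x))
        + β x (Y x) • (η x (shear ξ β x (Z x)) • X x - g x (X x) (shear ξ β x (Z x)) • ξ x)
        - β x (X x) • (η x (shear ξ β x (Z x)) • Y x - g x (Y x) (shear ξ β x (Z x)) • ξ x) := by
    generalize shear ξ β x (Z x) = w
    have h1 := h.curvature_reeb_left hR (Y x) w
    have h2 := h.curvature_reeb_left hR (X x) w
    have h3 := h.curvature_reeb_left hR (ξ x) w
    have h4 := hR.swap hx' (X x) (ξ x) w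
    rw [h2] at h4
    rw [h.apply_reeb_left hx', sub_self] at h3
    simp only [shear_apply, map_add, map_smul, LinearMap.add_apply, LinearMap.smul_apply, h1, h3,
      h4]
    module
  rw [shearCurvature_apply, hRP, hR x hx' X Y _ hX hY hPZ, key hX hY, key hY hX,
    shearConnection_apply, hclosed, ← map_sub, ← map_sub, hDΦ, hDΦ]
  congr 1
  simp only [map_add, map_smul]
  module

theorem extDeriv_add {α : OneForm d M ℝ} (hα : FormSmoothAt α x) (hβ : FormSmoothAt β x) :
    extDeriv (fun y ↦ α y + β y) x = extDeriv α x + extDeriv β x := by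
  ext v w
  obtain ⟨X, hX, rfl⟩ := exists_vSmoothAt v
  obtain ⟨Y, hY, rfl⟩ := exists_vSmoothAt w
  have hαβ : FormSmoothAt (fun y ↦ α y + β y) x := formSmoothAt_iff.2 fun Z hZ ↦
    (formSmoothAt_iff.1 hα Z hZ).add (formSmoothAt_iff.1 hβ Z hZ)
  have hX := hX.vDiffAt
  have hY := hY.vDiffAt
  have hα := hα.formDiffAt
  have hβ := hβ.formDiffAt
  rw [add_apply, add_apply, extDeriv_apply hαβ.formDiffAt hX hY, extDeriv_apply hα hX hY,
    extDeriv_apply hβ hX hY]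
  simp only [add_apply]
  rw [mvfderiv_fun_add (hα.apply hX) (hβ.apply hX), mvfderiv_fun_add (hα.apply hY) (hβ.apply hY)]
  simp only [add_apply]
  ring

theorem IsSasakiOn.transverseMetric_eq (h : IsSasakiOn g Φ ξ η D Set.univ)
    (v w : TangentSpace (𝓡 d) x) :
    transverseMetric η Φ x v w = g x v w - η x v * η x w := by
  have hx := Set.mem_univ x
  rw [transverseMetric_apply, h.extDeriv_form isOpen_univ hx, h.skew hx, h.end_end]
  simp only [map_add, map_neg, map_smul, h.apply_reeb_right hx, smul_eq_mul]
  ring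

theorem IsSasakiOn.transverseMetric_add_closed (h : IsSasakiOn g Φ ξ η D Set.univ)
    (hβ : FormSmoothAt β x) (hd : extDeriv β x = 0)
    (hΦ' : ∀ v, Φ' x v = unshear ξ β x (Φ x v)) :
    transverseMetric (fun y ↦ η y + β y) Φ' x = transverseMetric η Φ x := by
  have hx := Set.mem_univ x
  ext v w
  rw [transverseMetric_apply, transverseMetric_apply, extDeriv_add (h.smooth_η x hx) hβ, hd,
    add_zero, h.extDeriv_form isOpen_univ hx, h.extDeriv_form isOpen_univ hx, hΦ',
    unshear_apply, map_sub, map_smul, h.apply_reeb_right hx, h.form_end isOpen_univ hx]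
  simp

theorem IsSasakiOn.contactMetric_add_closed (h : IsSasakiOn g Φ ξ η D Set.univ)
    (hβ : FormSmoothAt β x) (hd : extDeriv β x = 0)
    (hΦ' : ∀ v, Φ' x v = unshear ξ β x (Φ x v)) (v w : TangentSpace (𝓡 d) x) :
    contactMetric (fun y ↦ η y + β y) Φ' x v w =
      g x (shear ξ β x v) (shear ξ β x w) := by
  have hx := Set.mem_univ x
  have e : contactMetric (fun y ↦ η y + β y) Φ' x v w =
      transverseMetric (fun y ↦ η y + β y) Φ' x v w
        + (η x v + β x v) * (η x w + β x w) := by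
    rw [contactMetric_apply, transverseMetric_apply]
    simp
  rw [e, h.transverseMetric_add_closed hβ hd hΦ', h.transverseMetric_eq]
  simp only [shear_apply, map_add, map_smul, add_apply, smul_apply, smul_eq_mul,
    h.apply_reeb_left hx, h.apply_reeb_right hx, h.form_reeb hx]
  ring

/-- A Sasaki-Einstein structure may be deformed by any closed one-form `β` with `β(ξ) = 0`. -/
theorem IsSasakiEinsteinOn.add_closed (h : IsSasakiEinsteinOn g Φ ξ η Set.univ)
    (hU : IsOpen U) (hβ : ∀ x ∈ U, FormSmoothAt β x) (hβξ : ∀ x, β x (ξ x) = 0)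
    (hd : ∀ x ∈ U, extDeriv β x = 0) (hΦ' : ∀ x v, Φ' x v = unshear ξ β x (Φ x v)) :
    IsSasakiEinsteinOn (contactMetric (fun x ↦ η x + β x) Φ') Φ' ξ (fun x ↦ η x + β x) U := by
  obtain ⟨D, hS, R, hR, c, hc⟩ := h
  have hg (x) (hx : x ∈ U) (v w) :=
    hS.contactMetric_add_closed (hβ x hx) (hd x hx) (hΦ' x) v w
  refine ⟨_, hS.isSasakiOn_shear hU hβ hβξ hd hg hΦ', _,
    hS.isCurvatureOn_shearCurvature hR hβ hβξ hd, c, fun x hx v w ↦ ?_⟩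
  rw [ricci_shearCurvature (hβξ x), hc x (Set.mem_univ x), hg x hx]

end Deformation

end SasakiEinstein

end

open SasakiEinstein in
theorem mainTheorem1 (n : ℕ) (M : Type*) [TopologicalSpace M] [T2Space M]
    [SecondCountableTopology M] [ChartedSpace (EuclideanSpace ℝ (Fin (2 * n + 1))) M]
    [IsManifold (𝓡 (2 * n + 1)) ∞ M]
    (g : BilinField (2 * n + 1) M ℝ) (Φ : EndField (2 * n + 1) M) (ξ : VField (2 * n + 1) M)
    (η : OneForm (2 * n + 1) M ℝ)
    (hM : IsSasakiEinsteinOn g Φ ξ η Set.univ)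
    (U : Set M) (hU : IsOpen U)
    (φ : M → ℝ) (hφ : IsBasicOn ξ φ U)
    (hdd : ∀ x ∈ U, ∀ v w : TangentSpace (𝓡 (2 * n + 1)) x, delDelbarB Φ φ x v w = 0) :
    IsSasakiEinsteinOn (deformedMetric Φ ξ η φ) (deformedEnd Φ ξ φ) ξ (deformedForm Φ η φ) U ∧
      ∀ x ∈ U, transverseMetric (deformedForm Φ η φ) (deformedEnd Φ ξ φ) x =
        transverseMetric η Φ x := by
  obtain ⟨D, hS, -⟩ := id hM
  have hβ (x) (hx : x ∈ U) : FormSmoothAt (dcB Φ φ) x :=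
    formSmoothAt_dcB (hφ.smooth.contMDiffAt (hU.mem_nhds hx)) (hS.smooth_Φ x (Set.mem_univ x))
  have hd (x) (hx : x ∈ U) : extDeriv (dcB Φ φ) x = 0 :=
    hS.extDeriv_dcB_eq_zero hU hφ hx (hdd x hx)
  have hΦ' (x : M) (v) : deformedEnd Φ ξ φ x v = unshear ξ (dcB Φ φ) x (Φ x v) := by
    simp [deformedEnd, unshear_apply]
  exact ⟨hM.add_closed hU hβ hS.dcB_reeb hd hΦ',
    fun x hx ↦ hS.transverseMetric_add_closed (hβ x hx) (hd x hx) (hΦ' x)⟩
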